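/- Let $k,d\in\mathbb N$ and $\alpha>0$. There is $\beta_\alpha>0$ (depending only on $k,d,\alpha$) such that for every $\beta\ge\beta_\alpha$ and all $c>0$, $R\ge 0$, $A>0$ there is a constant $C>0$ (depending only on $k,d,\alpha,\beta,c,R,A$, in particular independent of $N$) for which the following holds. Let $N>1$ be a real number and let $P(x)=\sum_{0<|\gamma|\le d}\xi_\gamma x^\gamma$ be a real polynomial on $\mathbb R^k$, where $\gamma\in\mathbb N_0^k$ and $|\gamma|=\gamma_1+\dots+\gamma_k$. Let $\Omega_N\subseteq\mathbb R^k$ be a convex set contained in a closed Euclidean ball $B_{cN}(x_0)$ of radius $cN$ whose centre $x_0\in\mathbb R^k$ satisfies $|x_0|\le RN$ (for instance, $x_0$ a fixed point with $|x_0|\le R$). Let $\varphi:\mathbb R^k\to\mathbb C$ be a $C^1$ function with $|\varphi(x)|\le A$ and $|\nabla\varphi(x)|\le A(1+|x|)^{-1}$ for all $x\in\mathbb R^k$. Put $$S_N=\sum_{n\in\Omega_N\cap\mathbb Z^k}e^{2\pi i P(n)}\varphi(n).$$ Suppose that for some multi-index $\gamma_0$ with $0<|\gamma_0|\le d$ there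 are integers $a,q$ with $0\le a\le q$, $\gcd(a,q)=1$, $$\Big|\xi_{\gamma_0}-\frac aq\Big|\le\frac1{q^2}\qquad\text{and}\qquad(\log N)^\beta\le q\le N^{|\gamma_0|}(\log N)^{-\beta}.$$ Then $$|S_N|\le C\,N^k(\log N)^{-\alpha}.$$ -/

import Mathlib

/-- The lattice point `n ∈ ℤ^k`, viewed in `ℝ^k` with its Euclidean norm. -/
noncomputable def latticePoint {k : ℕ} (n : Fin k → ℤ) : EuclideanSpace ℝ (Fin k) :=
  WithLp.toLp 2 (fun i => (n i : ℝ))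

/-- Only finitely many lattice points lie in a bounded set, so the sum in `weylSum` over a bounded
set is an ordinary finite sum. -/
theorem finite_latticePoint_mem {k : ℕ} {Ω : Set (EuclideanSpace ℝ (Fin k))}
    (hΩ : Bornology.IsBounded Ω) : {n : Fin k → ℤ | latticePoint n ∈ Ω}.Finite := by
  obtain ⟨r, hr⟩ := hΩ.subset_closedBall 0
  refine (Set.finite_Icc (fun _ : Fin k => -⌈r⌉) (fun _ => ⌈r⌉)).subset ?_
  intro n hn
  have h1 : ‖latticePoint n‖ ≤ r := by simpa using hr hn
  have h2 : ∀ i, |(n i : ℝ)| ≤ r := fun i => by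
    have := PiLp.norm_apply_le (latticePoint n) i
    simpa [latticePoint] using this.trans h1
  refine ⟨fun i => ?_, fun i => ?_⟩
  · have := (abs_le.1 (h2 i)).1
    have h3 := Int.le_ceil r
    have : ((-⌈r⌉ : ℤ) : ℝ) ≤ (n i : ℝ) := by push_cast; linarith
    exact_mod_cast this
  · have := (abs_le.1 (h2 i)).2
    have h3 := Int.le_ceil r
    have : (n i : ℝ) ≤ ((⌈r⌉ : ℤ) : ℝ) := by linarith
    exact_mod_cast this

/-- The weighted Weyl sum `∑_{n ∈ Ω ∩ ℤ^k} e^{2πi P(n)} φ(n)`. -/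
noncomputable def weylSum {k : ℕ} (P : MvPolynomial (Fin k) ℝ)
    (Ω : Set (EuclideanSpace ℝ (Fin k))) (φ : EuclideanSpace ℝ (Fin k) → ℂ) : ℂ :=
  ∑ᶠ n ∈ {n : Fin k → ℤ | latticePoint n ∈ Ω},
    Complex.exp (2 * Real.pi * Complex.I * (MvPolynomial.eval (fun i => (n i : ℝ)) P : ℝ))
      * φ (latticePoint n)

/-!
Write `L = log N`. The estimate is proved in contrapositive form. If the weighted Weyl sum exceeds
`N ^ k L ^ (-α)` by a constant factor, then every coefficient `ξ_γ` with `γ ≠ 0` is within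
`L ^ O(1) / N ^ |γ|` of a rational number with denominator at most `L ^ O(1)`
(`IsLargeSum.exists_common_denominator`). For `γ = γ₀` this is incompatible with the reduced
approximation `a / q` once `β` is larger than the exponents involved
(`false_of_two_approximations`). For bounded `N` the trivial bound is enough.

All losses in the inverse statement have to be powers of the loss `K` in the exponential sum; a
factor `N ^ ε` would not be acceptable. For the leading coefficient in one variable
(`exists_distInt_leadingCoeff_le`) the argument is an induction on the degree by van der Corput
differencing. For many shifts `h` the leading coefficient `d h a_d` of `f(X + h) - f(X)` is close to
a rational number with denominator `q_h ≤ K ^ O(1)`. Since there are only `K ^ O(1)` possible values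
of `q_h`, one of them occurs for many `h`, and so the multiples `h (q d a_d)` are often close to
integers. This forces `q d a_d` itself to be close to a rational number with small denominator,
with a gain of a factor `M` in the error (`exists_distInt_mul_le_of_dense`). No divisor bound is
used.

In several variables the coefficients are found by descending degree. A weighted sum is compared
with its averages along progressions of direction `q h`, where `h` runs through a fixed finite grid
and `q` is a common denominator for the coefficients of degree above `j` (`mul_norm_tsum_le`). This
costs only the total variation of the weight, which for a weight with gradient `O(1 / |x|)` cut off
to a convex set is `O(N ^ (k - 1) log N)` in each coordinate direction, since a line meets a convex
set in an interval (`variation_latticeCutoff_mul_le`). On a short enough progression the part of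
degree above `j` is constant modulo `1` up to a small error. The remaining part has degree at most
`j`, and its leading coefficient `q ^ j P_j(h)` does not depend on the base point of the
progression, so the one-variable result applies to it
(`IsLargeSum.exists_distInt_formPart_le`). Finite differences in `h` recover the coefficients of the
form `P_j` from its values on the grid (`sum_choose_mul_formPart`).
-/

/-! ### Distance to the nearest integer -/

/-- The distance from a real number to the nearest integer. -/
noncomputable def distInt (x : ℝ) : ℝ := |x - round x|

theorem distInt_eq_norm (x : ℝ) : distInt x = ‖(x : UnitAddCircle)‖ :=
  (UnitAddCircle.norm_eq).symm

theorem distInt_nonneg (x : ℝ) : 0 ≤ distInt x := abs_nonneg _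

theorem distInt_le_half (x : ℝ) : distInt x ≤ 1 / 2 := abs_sub_round x

theorem distInt_le_abs_sub_int (x : ℝ) (z : ℤ) : distInt x ≤ |x - z| := round_le x z

theorem distInt_add_le (x y : ℝ) : distInt (x + y) ≤ distInt x + distInt y := by
  simp only [distInt_eq_norm, AddCircle.coe_add]
  exact norm_add_le _ _

theorem distInt_sub_le (x y : ℝ) : distInt (x - y) ≤ distInt x + distInt y := by
  simp only [distInt_eq_norm, AddCircle.coe_sub]
  exact norm_sub_le _ _

theorem distInt_add_int (x : ℝ) (z : ℤ) : distInt (x + z) = distInt x := by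
  simp [distInt]

theorem distInt_int_mul_le (z : ℤ) (x : ℝ) : distInt (z * x) ≤ |(z : ℝ)| * distInt x := by
  have h := distInt_le_abs_sub_int (z * x) (z * round x)
  refine h.trans_eq ?_
  rw [distInt, ← abs_mul]
  push_cast
  ring_nf

theorem distInt_nat_mul_le (n : ℕ) (x : ℝ) : distInt (n * x) ≤ n * distInt x := by
  simpa using distInt_int_mul_le n x

theorem distInt_sum_le {ι : Type*} (s : Finset ι) (f : ι → ℝ) :
    distInt (∑ i ∈ s, f i) ≤ ∑ i ∈ s, distInt (f i) := by
  classical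
  induction s using Finset.induction_on with
  | empty => simp [distInt]
  | insert i s hi ih =>
    rw [Finset.sum_insert hi, Finset.sum_insert hi]
    exact (distInt_add_le _ _).trans (by gcongr)

theorem distInt_of_abs_le_half {x : ℝ} (hx : |x| ≤ 1 / 2) : distInt x = |x| := by
  rw [distInt_eq_norm]
  have := (AddCircle.norm_coe_eq_abs_iff (p := (1 : ℝ)) (x := x) one_ne_zero).2 (by simpa using hx)
  exact this

/-- Finitely many numbers that each have a good multiple with a small denominator have one with a
common denominator, namely the product of the individual ones. -/
theorem exists_common_multiplier {ι : Type*} (s : Finset ι) (x : ι → ℝ) {Q ε : ℝ} (hQ : 1 ≤ Q)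
    (h : ∀ i ∈ s, ∃ q : ℕ, 1 ≤ q ∧ (q : ℝ) ≤ Q ∧ distInt (q * x i) ≤ ε) :
    ∃ q : ℕ, 1 ≤ q ∧ (q : ℝ) ≤ Q ^ s.card ∧ ∀ i ∈ s, distInt (q * x i) ≤ Q ^ s.card * ε := by
  classical
  choose! q hq1 hqQ hqx using h
  have hprod : ∀ t ⊆ s, ((∏ j ∈ t, q j : ℕ) : ℝ) ≤ Q ^ t.card := by
    intro t ht
    push_cast
    rw [← Finset.prod_const]
    exact Finset.prod_le_prod (fun _ _ => Nat.cast_nonneg _) fun j hj => hqQ j (ht hj)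
  refine ⟨∏ j ∈ s, q j, Nat.succ_le_of_lt (Finset.prod_pos hq1), hprod s subset_rfl, fun i hi => ?_⟩
  have hε : 0 ≤ ε := (distInt_nonneg _).trans (hqx i hi)
  rw [← Finset.prod_erase_mul s q hi]
  push_cast
  rw [mul_assoc, ← Nat.cast_prod]
  refine (distInt_nat_mul_le _ _).trans ?_
  refine mul_le_mul ?_ (hqx i hi) (distInt_nonneg _) (by positivity)
  refine (hprod _ (Finset.erase_subset _ _)).trans ?_
  exact pow_le_pow_right₀ hQ (Finset.card_le_card (Finset.erase_subset _ _))

/-! ### The additive character -/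

/-- The additive character `x ↦ e^{2πix}` of `ℝ`. -/
noncomputable def ee (x : ℝ) : ℂ := Complex.exp (2 * Real.pi * Complex.I * x)

theorem ee_add (x y : ℝ) : ee (x + y) = ee x * ee y := by
  simp only [ee, ← Complex.exp_add]
  congr 1
  push_cast
  ring

theorem ee_eq_exp_ofReal_mul_I (x : ℝ) : ee x = Complex.exp ((2 * Real.pi * x : ℝ) * Complex.I) := by
  rw [ee]
  congr 1
  push_cast
  ring

theorem norm_ee (x : ℝ) : ‖ee x‖ = 1 := by
  rw [ee_eq_exp_ofReal_mul_I, Complex.norm_exp_ofReal_mul_I]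

theorem ee_int (z : ℤ) : ee z = 1 := by
  rw [ee, Complex.exp_eq_one_iff]
  exact ⟨z, by push_cast; ring⟩

theorem conj_ee (x : ℝ) : (starRingEnd ℂ) (ee x) = ee (-x) := by
  rw [ee, ee, ← Complex.exp_conj]
  congr 1
  simp [Complex.conj_ofNat]

theorem ee_sub (x y : ℝ) : ee (x - y) = ee x * (starRingEnd ℂ) (ee y) := by
  rw [sub_eq_add_neg, ee_add, conj_ee]

theorem norm_ee_sub_one (x : ℝ) : ‖ee x - 1‖ = 2 * |Real.sin (Real.pi * x)| := by
  have h := Complex.norm_exp_I_mul_ofReal_sub_one (2 * Real.pi * x)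
  rw [ee_eq_exp_ofReal_mul_I, mul_comm, h, Real.norm_eq_abs, abs_mul, abs_two]
  ring_nf

theorem norm_ee_sub_one_le (x : ℝ) : ‖ee x - 1‖ ≤ 2 * Real.pi * |x| := by
  rw [norm_ee_sub_one]
  have h : |Real.sin (Real.pi * x)| ≤ |Real.pi * x| := Real.abs_sin_le_abs
  rw [abs_mul, abs_of_pos Real.pi_pos] at h
  linarith

theorem distInt_le_norm_ee_sub_one (x : ℝ) : distInt x ≤ ‖ee x - 1‖ := by
  have h1 : ee x = ee (x - round x) := by
    conv_lhs => rw [← sub_add_cancel x (round x : ℝ), ee_add, ee_int, mul_one]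
  rw [h1, norm_ee_sub_one]
  have h2 := distInt_le_half x
  rw [distInt] at h2 ⊢
  have h3 : |Real.pi * (x - round x)| ≤ Real.pi / 2 := by
    rw [abs_mul, abs_of_pos Real.pi_pos]
    nlinarith [Real.pi_pos]
  have h4 := Real.mul_abs_le_abs_sin h3
  rw [abs_mul, abs_of_pos Real.pi_pos] at h4
  have h5 : 2 / Real.pi * (Real.pi * |x - round x|) = 2 * |x - round x| := by
    field_simp
  linarith [abs_nonneg (x - round x)]

/-- Bound for a geometric sum. -/
theorem distInt_mul_norm_sum_le (a b : ℝ) (M : ℕ) :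
    distInt a * ‖∑ m ∈ Finset.range M, ee (a * m + b)‖ ≤ 2 := by
  have h1 : ∀ m : ℕ, ee (a * m + b) = ee b * ee a ^ m := by
    intro m
    induction m with
    | zero => simp
    | succ m ih =>
      rw [pow_succ, ← mul_assoc, ← ih, ← ee_add]
      congr 1
      push_cast
      ring
  have h2 : (∑ m ∈ Finset.range M, ee (a * m + b)) * (ee a - 1) = ee b * (ee a ^ M - 1) := by
    simp only [h1]
    rw [← Finset.mul_sum, mul_assoc, geom_sum_mul]
  calc distInt a * ‖∑ m ∈ Finset.range M, ee (a * m + b)‖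
      ≤ ‖ee a - 1‖ * ‖∑ m ∈ Finset.range M, ee (a * m + b)‖ := by
        gcongr
        exact distInt_le_norm_ee_sub_one a
    _ = ‖ee b * (ee a ^ M - 1)‖ := by rw [← norm_mul, mul_comm, h2]
    _ ≤ 2 := by
        rw [norm_mul, norm_ee, one_mul]
        refine (norm_sub_le _ _).trans ?_
        rw [norm_pow, norm_ee]
        norm_num

/-! ### Powers absorb constants -/

theorem natCast_le_pow {K : ℝ} (hK : 2 ≤ K) (n : ℕ) : (n : ℝ) ≤ K ^ n := by
  have h1 : (n : ℝ) ≤ 2 ^ n := by exact_mod_cast (Nat.lt_two_pow_self (n := n)).le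
  exact h1.trans (pow_le_pow_left₀ (by norm_num) hK n)

/-! ### Multiples of a number that are often close to integers -/

/-- A finite set of natural numbers in one residue class modulo `r` has two elements that differ by
at least `r` times its cardinality minus one. -/
theorem exists_mul_add_of_residue_class {T : Finset ℕ} {r b : ℕ}
    (hT : T.Nonempty) (hmod : ∀ h ∈ T, h % r = b) :
    ∃ h ∈ T, ∃ h' ∈ T, ∃ m : ℕ, h' = h + r * m ∧ T.card ≤ m + 1 := by
  have hmm := T.min'_le _ (T.max'_mem hT)
  have hdiv : T.min' hT / r ≤ T.max' hT / r := Nat.div_le_div_right hmm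
  refine ⟨T.min' hT, T.min'_mem hT, T.max' hT, T.max'_mem hT,
    T.max' hT / r - T.min' hT / r, ?_, ?_⟩
  · have h1 := Nat.div_add_mod (T.max' hT) r
    have h2 := Nat.div_add_mod (T.min' hT) r
    rw [hmod _ (T.max'_mem hT)] at h1
    rw [hmod _ (T.min'_mem hT)] at h2
    rw [Nat.mul_sub]
    have h3 := Nat.mul_le_mul_left r hdiv
    omega
  · have hsub : T.card ≤ (Finset.Icc (T.min' hT / r) (T.max' hT / r)).card := by
      refine Finset.card_le_card_of_injOn (fun h => h / r) (fun h hh => ?_) ?_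
      · simp only [Finset.coe_Icc, Set.mem_Icc]
        exact ⟨Nat.div_le_div_right (T.min'_le _ hh), Nat.div_le_div_right (T.le_max' _ hh)⟩
      · intro x hx y hy hxy
        have h1 := Nat.div_add_mod x r
        have h2 := Nat.div_add_mod y r
        rw [hmod _ hx] at h1
        rw [hmod _ hy] at h2
        simp only at hxy
        rw [hxy] at h1
        omega
    rw [Nat.card_Icc] at hsub
    omega

/-- If `hθ` is close to an integer for a positive proportion of the `h < M`, then some `r ≥ 1` of
bounded size has `rθ` even closer to an integer, by a factor of order `M`. -/
theorem exists_distInt_mul_le_of_dense {K ε θ : ℝ} {M : ℕ} {S : Finset ℕ} (hK : 2 ≤ K)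
    (hS : S ⊆ Finset.range M) (hcard : (M : ℝ) ≤ K * S.card)
    (hθ : ∀ h ∈ S, distInt (h * θ) ≤ ε) (hM : 16 * K ^ 2 ≤ M) (hε : 128 * K * ε < 1) :
    ∃ r : ℕ, 1 ≤ r ∧ (r : ℝ) ≤ 2 * K ∧ distInt (r * θ) * M ≤ 16 * K ^ 2 * ε := by
  classical
  have hM0 : (0 : ℝ) < M := by nlinarith
  have hdiff : ∀ h ∈ S, ∀ h' ∈ S, ∀ r : ℕ, h' = h + r → distInt (r * θ) ≤ 2 * ε := by
    intro h hh h' hh' r hr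
    have h1 : (r : ℝ) * θ = h' * θ - h * θ := by rw [hr]; push_cast; ring
    rw [h1]
    linarith [distInt_sub_le (h' * θ) (h * θ), hθ h hh, hθ h' hh']
  -- Two elements of `S` at distance at most `2 * K` give the multiplier `r`.
  obtain ⟨r, hr1, hrK, hr⟩ : ∃ r : ℕ, 1 ≤ r ∧ (r : ℝ) ≤ 2 * K ∧ distInt (r * θ) ≤ 2 * ε := by
    set w : ℕ := ⌊2 * K⌋₊ with hw
    have hw1 : 1 ≤ w := Nat.le_floor (by push_cast; linarith)
    have hwK : (w : ℝ) ≤ 2 * K := Nat.floor_le (by linarith)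
    have hwK' : 2 * K < w + 1 := Nat.lt_floor_add_one _
    have hpig : (Finset.range (M / w + 1)).card * 1 < S.card := by
      rw [Finset.card_range, mul_one]
      have h1 : ((M / w : ℕ) : ℝ) ≤ M / w := Nat.cast_div_le
      have h2 : (M : ℝ) / w + 1 < S.card := by
        have h3 : (M : ℝ) / K ≤ S.card := by rw [div_le_iff₀ (by linarith)]; linarith
        have hw4 : 3 * K / 2 ≤ w := by linarith
        have h4 : (M : ℝ) / w ≤ M / (3 * K / 2) := by gcongr
        have h5 : (M : ℝ) / (3 * K / 2) = M / K * (2 / 3) := by field_simp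
        have h6 : 16 * K ≤ M / K := by rw [le_div_iff₀ (by linarith)]; nlinarith
        linarith
      have : ((M / w + 1 : ℕ) : ℝ) < S.card := by push_cast; linarith
      exact_mod_cast this
    obtain ⟨y, -, hy⟩ := Finset.exists_lt_card_fiber_of_mul_lt_card_of_maps_to
      (f := fun h => h / w) (fun h hh => by
        have := Finset.mem_range.1 (hS hh)
        simp only [Finset.mem_range]
        exact Nat.lt_succ_of_le (Nat.div_le_div_right this.le)) hpig
    obtain ⟨a, ha, b, hb, hab⟩ := Finset.one_lt_card.1 hy
    simp only [Finset.mem_filter] at ha hb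
    wlog hlt : a < b generalizing a b
    · exact this b a hab.symm hb ha (by omega)
    refine ⟨b - a, by omega, ?_, hdiff a ha.1 b hb.1 (b - a) (by omega)⟩
    have h1 := Nat.div_add_mod a w
    have h2 := Nat.div_add_mod b w
    have h3 := Nat.mod_lt b hw1
    rw [ha.2] at h1
    rw [hb.2] at h2
    have : b - a ≤ w := by omega
    exact le_trans (by exact_mod_cast this) hwK
  refine ⟨r, hr1, hrK, ?_⟩
  have hr0 : (0 : ℝ) < r := by exact_mod_cast hr1
  have hε0 : 0 ≤ ε := by linarith [distInt_nonneg (r * θ)]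
  set z := round (r * θ) with hz
  set η := r * θ - z with hη
  have hηd : distInt (r * θ) = |η| := rfl
  rw [hηd] at hr ⊢
  -- On a block of length `ℓ` the multiples of `η` do not wrap around.
  have key : ∀ ℓ : ℕ, 1 ≤ ℓ → ℓ ≤ M → ℓ * |η| ≤ r / 4 → (ℓ / (2 * K * r) - 1) * |η| ≤ 2 * ε := by
    intro ℓ hℓ1 hℓM hℓη
    have hℓ0 : (0 : ℝ) < ℓ := by exact_mod_cast hℓ1
    have hpig : ((Finset.range (M / ℓ + 1) ×ˢ Finset.range r).card) • ((ℓ : ℝ) / (2 * K * r))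
        ≤ S.card := by
      rw [Finset.card_product, Finset.card_range, Finset.card_range, nsmul_eq_mul]
      have h1 : ((M / ℓ : ℕ) : ℝ) ≤ M / ℓ := Nat.cast_div_le
      have h2 : (1 : ℝ) ≤ M / ℓ := by
        rw [le_div_iff₀ hℓ0, one_mul]
        exact_mod_cast hℓM
      have h3 : (M : ℝ) / K ≤ S.card := by rw [div_le_iff₀ (by linarith)]; linarith
      push_cast
      calc (((M / ℓ : ℕ) : ℝ) + 1) * r * (ℓ / (2 * K * r))
          ≤ (2 * (M / ℓ)) * r * (ℓ / (2 * K * r)) := by gcongr; linarith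
        _ = M / K := by field_simp
        _ ≤ S.card := h3
    obtain ⟨⟨y, b⟩, -, hy⟩ := Finset.exists_le_card_fiber_of_nsmul_le_card_of_maps_to
      (f := fun h => (h / ℓ, h % r)) (fun h hh => by
        have := Finset.mem_range.1 (hS hh)
        simp only [Finset.mem_product, Finset.mem_range]
        exact ⟨Nat.lt_succ_of_le (Nat.div_le_div_right this.le), Nat.mod_lt _ hr1⟩)
      ⟨(0, 0), by simp; omega⟩ hpig
    set T := S.filter (fun h => (h / ℓ, h % r) = (y, b)) with hT
    have hTne : T.Nonempty := by
      rw [← Finset.card_pos]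
      have : (0 : ℝ) < T.card := lt_of_lt_of_le (by positivity) hy
      exact_mod_cast this
    have hTmem : ∀ h ∈ T, h ∈ S ∧ h / ℓ = y ∧ h % r = b := by
      intro h hh
      simpa [hT, Finset.mem_filter] using hh
    obtain ⟨h, hh, h', hh', m, hm, hc⟩ :=
      exists_mul_add_of_residue_class hTne fun h hh => (hTmem h hh).2.2
    have hlen : r * m < ℓ := by
      have h1 := Nat.div_add_mod h ℓ
      have h2 := Nat.div_add_mod h' ℓ
      have h3 := Nat.mod_lt h' hℓ1
      rw [(hTmem h hh).2.1] at h1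
      rw [(hTmem h' hh').2.1] at h2
      omega
    have hlen' : (r : ℝ) * m ≤ ℓ := by exact_mod_cast hlen.le
    have hsmall : |m * η| ≤ 1 / 2 := by
      rw [abs_mul, Nat.abs_cast]
      have : r * (m * |η|) ≤ r * (1 / 4) := by
        calc r * (m * |η|) = r * m * |η| := by ring
          _ ≤ ℓ * |η| := by gcongr
          _ ≤ r * (1 / 4) := by linarith
      have := le_of_mul_le_mul_left this hr0
      linarith
    have hmη : m * |η| ≤ 2 * ε := by
      have h1 := distInt_of_abs_le_half hsmall
      rw [abs_mul, Nat.abs_cast] at h1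
      rw [← h1]
      have h2 : ((r * m : ℕ) : ℝ) * θ = m * η + ((m * z : ℤ) : ℝ) := by
        rw [hη]; push_cast; ring
      have h3 := hdiff h (hTmem h hh).1 h' (hTmem h' hh').1 (r * m) hm
      rwa [h2, distInt_add_int] at h3
    have hc' : (T.card : ℝ) ≤ m + 1 := by exact_mod_cast hc
    refine le_trans ?_ hmη
    gcongr
    linarith
  have hrK2 : 2 * K * r ≤ 4 * K ^ 2 := by nlinarith
  have hdivr : ∀ x : ℝ, 0 ≤ x → x / (4 * K ^ 2) ≤ x / (2 * K * r) := by
    intro x hx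
    gcongr
  -- If `M * |η|` is small, the whole range is one block. Otherwise a block of the maximal length
  -- without wrap-around already contradicts the smallness of `ε`.
  rcases le_or_gt ((M : ℝ) * |η|) (r / 4) with hcase | hcase
  · have h1 := key M (by exact_mod_cast (show (0 : ℝ) < M from hM0)) le_rfl hcase
    have h2 := hdivr M hM0.le
    have h3 : (1 : ℝ) ≤ M / (8 * K ^ 2) := by rw [le_div_iff₀ (by positivity)]; nlinarith
    have h4 : (M : ℝ) / (4 * K ^ 2) = 2 * (M / (8 * K ^ 2)) := by field_simp; norm_num
    have h5 : (M / (8 * K ^ 2)) * |η| ≤ 2 * ε := by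
      refine le_trans ?_ h1
      gcongr
      linarith
    have h6 : |η| * M = (M / (8 * K ^ 2)) * |η| * (8 * K ^ 2) := by field_simp
    rw [h6]
    calc (M / (8 * K ^ 2)) * |η| * (8 * K ^ 2) ≤ 2 * ε * (8 * K ^ 2) := by gcongr
      _ = 16 * K ^ 2 * ε := by ring
  · exfalso
    have hη0 : 0 < |η| := by
      by_contra hcon
      have : |η| = 0 := le_antisymm (not_lt.1 hcon) (abs_nonneg _)
      rw [this] at hcase
      linarith
    have hε' : 2 * ε < 1 / 16 := by nlinarith
    set ℓ := ⌊r / (4 * |η|)⌋₊ with hℓ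
    have hr1' : (1 : ℝ) ≤ r := by exact_mod_cast hr1
    have hx1 : 1 ≤ r / (4 * |η|) := by rw [le_div_iff₀ (by positivity)]; linarith
    have hℓ1 : 1 ≤ ℓ := Nat.le_floor (by exact_mod_cast hx1)
    have hℓle : (ℓ : ℝ) ≤ r / (4 * |η|) := Nat.floor_le (by linarith)
    have hℓlt : r / (4 * |η|) < ℓ + 1 := Nat.lt_floor_add_one _
    have hℓM : ℓ ≤ M := by
      have : (ℓ : ℝ) ≤ M := by
        refine hℓle.trans ?_
        rw [div_le_iff₀ (by positivity)]
        linarith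
      exact_mod_cast this
    have h1 := key ℓ hℓ1 hℓM (by
      rw [le_div_iff₀ (by positivity)] at hℓle
      linarith)
    have hℓ1' : (1 : ℝ) ≤ ℓ := by exact_mod_cast hℓ1
    have hhalf : r / (8 * |η|) ≤ ℓ := by
      have : r / (8 * |η|) = r / (4 * |η|) / 2 := by field_simp; norm_num
      linarith
    have h2 : 1 / (16 * K) ≤ ℓ / (2 * K * r) * |η| := by
      calc 1 / (16 * K) = r / (8 * |η|) / (2 * K * r) * |η| := by field_simp; norm_num
        _ ≤ ℓ / (2 * K * r) * |η| := by gcongr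
    have h3 : 1 / (16 * K) ≤ 4 * ε := by linarith
    rw [div_le_iff₀ (by linarith)] at h3
    nlinarith

/-! ### Exponential sums of polynomials in one variable -/

section

open Polynomial

/-- Van der Corput's inequality, in the form that compares the sum with all its shifts. -/
theorem norm_sum_sq_le_sum_shift (f : ℕ → ℂ) (M : ℕ) :
    ‖∑ m ∈ Finset.range M, f m‖ ^ 2 ≤ 2 * ∑ h ∈ Finset.range M,
      ‖∑ m ∈ Finset.range (M - h), f (m + h) * (starRingEnd ℂ) (f m)‖ := by
  set c := fun z : ℂ => (starRingEnd ℂ) z with hc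
  set D := ∑ h ∈ Finset.range M, ∑ m ∈ Finset.range (M - h), f (m + h) * c (f m) with hD
  set E := ∑ m ∈ Finset.range M, f m * c (f m) with hE
  have htri : D = ∑ m ∈ Finset.range M, ∑ n ∈ Finset.range M,
      if m ≤ n then f n * c (f m) else 0 := by
    simp only [← Finset.sum_filter]
    rw [hD, Finset.sum_sigma', Finset.sum_sigma']
    refine Finset.sum_bij' (fun x _ => ⟨x.2, x.2 + x.1⟩) (fun x _ => ⟨x.2 - x.1, x.1⟩) ?_ ?_ ?_ ?_ ?_
    · rintro ⟨h, m⟩ hx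
      simp only [Finset.mem_sigma, Finset.mem_range, Finset.mem_filter] at hx ⊢
      omega
    · rintro ⟨h, m⟩ hx
      simp only [Finset.mem_sigma, Finset.mem_range, Finset.mem_filter] at hx ⊢
      omega
    · rintro ⟨h, m⟩ hx
      simp
    · rintro ⟨m, n⟩ hx
      simp only [Finset.mem_sigma, Finset.mem_range, Finset.mem_filter] at hx ⊢
      simp only [Sigma.mk.injEq, heq_eq_eq, true_and]
      omega
    · rintro ⟨h, m⟩ hx
      rfl
  have hsq : (∑ m ∈ Finset.range M, f m) * c (∑ m ∈ Finset.range M, f m) = D + c D - E := by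
    have h1 : c D = ∑ m ∈ Finset.range M, ∑ n ∈ Finset.range M,
        if n ≤ m then f n * c (f m) else 0 := by
      rw [htri, Finset.sum_comm]
      simp only [hc, map_sum]
      refine Finset.sum_congr rfl fun m _ => Finset.sum_congr rfl fun n _ => ?_
      split_ifs
      · simp [mul_comm]
      · simp
    have h2 : E = ∑ m ∈ Finset.range M, ∑ n ∈ Finset.range M,
        if n = m then f n * c (f m) else 0 := by
      rw [hE]
      refine Finset.sum_congr rfl fun m hm => ?_
      rw [Finset.sum_ite_eq' _ m, if_pos hm]
    rw [h1, h2, htri, ← Finset.sum_add_distrib, ← Finset.sum_sub_distrib, mul_comm]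
    simp only [hc, map_sum]
    rw [Finset.sum_mul_sum]
    refine Finset.sum_congr rfl fun m _ => ?_
    rw [← Finset.sum_add_distrib, ← Finset.sum_sub_distrib]
    refine Finset.sum_congr rfl fun n _ => ?_
    rcases lt_trichotomy m n with h | h | h
    · rw [if_pos h.le, if_neg (by omega), if_neg (by omega)]; ring
    · subst h; simp [mul_comm]
    · rw [if_neg (by omega), if_pos h.le, if_neg (by omega)]; ring
  have hre : ‖∑ m ∈ Finset.range M, f m‖ ^ 2 = 2 * D.re - E.re := by
    have := congrArg Complex.re hsq
    rw [hc] at this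
    simp only [Complex.mul_conj, Complex.ofReal_re, Complex.sub_re, Complex.add_re,
      Complex.conj_re] at this
    rw [Complex.normSq_eq_norm_sq] at this
    linarith
  have hEre : 0 ≤ E.re := by
    rw [hE, Complex.re_sum]
    refine Finset.sum_nonneg fun m _ => ?_
    simp only [hc, Complex.mul_conj, Complex.ofReal_re]
    exact Complex.normSq_nonneg _
  have hDle : D.re ≤ ∑ h ∈ Finset.range M,
      ‖∑ m ∈ Finset.range (M - h), f (m + h) * c (f m)‖ :=
    (Complex.re_le_norm D).trans (norm_sum_le _ _)
  linarith

/-- If the average of numbers in `[0, M]` is at least `δM`, then a proportion `δ/2` of them is at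
least `δM/2`. -/
theorem card_filter_ge_of_sum_ge {M : ℕ} {x : ℕ → ℝ} {δ : ℝ}
    (hx : ∀ h < M, x h ≤ M) (hδ : 0 ≤ δ) (hsum : δ * M ^ 2 ≤ ∑ h ∈ Finset.range M, x h) :
    δ / 2 * M ≤ ((Finset.range M).filter fun h => δ / 2 * M ≤ x h).card := by
  classical
  rcases Nat.eq_zero_or_pos M with rfl | hM
  · simp
  have hM0 : (0 : ℝ) < M := by exact_mod_cast hM
  set S := (Finset.range M).filter fun h => δ / 2 * M ≤ x h with hS
  rw [← Finset.sum_filter_add_sum_filter_not _ (fun h => δ / 2 * M ≤ x h)] at hsum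
  have h1 : ∑ h ∈ S, x h ≤ S.card * M := by
    rw [← nsmul_eq_mul]
    refine Finset.sum_le_card_nsmul _ _ _ fun h hh => hx h ?_
    exact Finset.mem_range.1 (Finset.mem_filter.1 hh).1
  have h2 : ∑ h ∈ (Finset.range M).filter (fun h => ¬ δ / 2 * M ≤ x h), x h ≤ M * (δ / 2 * M) := by
    calc _ ≤ (((Finset.range M).filter (fun h => ¬ δ / 2 * M ≤ x h)).card : ℝ) * (δ / 2 * M) := by
          rw [← nsmul_eq_mul]
          refine Finset.sum_le_card_nsmul _ _ _ fun h hh => ?_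
          exact (not_le.1 (Finset.mem_filter.1 hh).2).le
      _ ≤ M * (δ / 2 * M) := by
          gcongr
          exact (Finset.card_filter_le _ _).trans (Finset.card_range M).le
  have h3 : δ / 2 * M * M ≤ S.card * M := by nlinarith
  exact le_of_mul_le_mul_right h3 hM0

/-- The leading coefficient of `f(X + h) - f(X)`. -/
theorem natDegree_taylor_sub_le {f : ℝ[X]} {d : ℕ} (hf : f.natDegree ≤ d + 1) (h : ℝ) :
    (taylor h f - f).natDegree ≤ d ∧ (taylor h f - f).coeff d = (d + 1) * h * f.coeff (d + 1) := by
  have hcoeff : ∀ n ≤ d + 1, (taylor h f).coeff n =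
      ∑ i ∈ Finset.range (d + 2 - n), ((i + n).choose n : ℝ) * f.coeff (i + n) * h ^ i := by
    intro n hn
    rw [taylor_coeff, eval_eq_sum_range' (n := d + 2 - n)]
    · simp [hasseDeriv_coeff]
    · refine lt_of_le_of_lt (natDegree_hasseDeriv_le _ _) ?_
      omega
  constructor
  · rw [natDegree_le_iff_coeff_eq_zero]
    intro n hn
    rcases eq_or_lt_of_le (Nat.succ_le_of_lt hn) with rfl | hn'
    · rw [coeff_sub, hcoeff _ le_rfl]
      simp
    · have h1 : f.coeff n = 0 := coeff_eq_zero_of_natDegree_lt (by omega)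
      have h2 : (taylor h f).coeff n = 0 :=
        coeff_eq_zero_of_natDegree_lt (by rw [natDegree_taylor]; omega)
      rw [coeff_sub, h1, h2, sub_zero]
  · rw [coeff_sub, hcoeff _ (Nat.le_succ d)]
    have : d + 2 - d = 2 := by omega
    rw [this, Finset.sum_range_succ, Finset.sum_range_one]
    simp [add_comm 1 d]
    ring

/-- Weyl's inequality with polynomial losses, for the leading coefficient: if the exponential sum of
a polynomial of degree `d` over `M` consecutive integers has size at least `M / K`, then the leading
coefficient is within `K ^ O(1) / M ^ d` of a rational number with denominator at most `K ^ O(1)`.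

Since the multiplier `q` is bounded by a power of `K`, the multipliers that the induction provides
for the differenced polynomials can be pigeonholed to a single one without losing more than a power
of `K`. -/
theorem exists_distInt_leadingCoeff_le (d : ℕ) (hd : 1 ≤ d) :
    ∃ B : ℕ, ∀ K : ℝ, 2 ≤ K → ∀ (M : ℕ) (f : ℝ[X]), f.natDegree ≤ d →
      (M : ℝ) ≤ K * ‖∑ m ∈ Finset.range M, ee (f.eval (m : ℝ))‖ →
      ∃ q : ℕ, 1 ≤ q ∧ (q : ℝ) ≤ K ^ B ∧ distInt (q * f.coeff d) * (M : ℝ) ^ d ≤ K ^ B := by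
  classical
  induction d, hd using Nat.le_induction with
  | base =>
    refine ⟨2, fun K hK M f hf hM => ⟨1, le_rfl, ?_, ?_⟩⟩
    · rw [Nat.cast_one]
      exact one_le_pow₀ (by linarith)
    · have h1 : ∀ m : ℕ, f.eval (m : ℝ) = f.coeff 1 * m + f.coeff 0 := by
        intro m
        conv_lhs => rw [eq_X_add_C_of_natDegree_le_one hf]
        simp
      simp only [h1] at hM
      have h2 := distInt_mul_norm_sum_le (f.coeff 1) (f.coeff 0) M
      rw [Nat.cast_one, one_mul, pow_one]
      calc distInt (f.coeff 1) * M ≤ distInt (f.coeff 1) *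
            (K * ‖∑ m ∈ Finset.range M, ee (f.coeff 1 * m + f.coeff 0)‖) := by
            gcongr
            exact distInt_nonneg _
        _ = K * (distInt (f.coeff 1) *
            ‖∑ m ∈ Finset.range M, ee (f.coeff 1 * m + f.coeff 0)‖) := by ring
        _ ≤ K * 2 := by gcongr
        _ ≤ K ^ 2 := by nlinarith
  | succ d hd ih =>
    obtain ⟨B, ih⟩ := ih
    set b := 12 + 8 * B + 4 * d with hb
    refine ⟨(12 + 12 * B + 4 * d) + (6 + 8 * B + d) + b * (d + 1), fun K hK M f hf hM => ?_⟩
    have hK1 : 1 ≤ K := by linarith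
    have hK0 : 0 < K := by linarith
    have hmono : ∀ {m n : ℕ}, m ≤ n → K ^ m ≤ K ^ n := fun h => pow_le_pow_right₀ hK1 h
    have htwo : ∀ n : ℕ, (2 : ℝ) ^ n ≤ K ^ n := fun n => pow_le_pow_left₀ (by norm_num) hK n
    -- For `M ≤ K ^ b` the bound `distInt ≤ 1 / 2` suffices, with `q = 1`.
    rcases le_or_gt (M : ℝ) (K ^ b) with hMb | hMb
    · refine ⟨1, le_rfl, by simpa using one_le_pow₀ hK1, ?_⟩
      calc distInt _ * (M : ℝ) ^ (d + 1) ≤ 1 * (K ^ b) ^ (d + 1) := by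
            gcongr
            exact (distInt_le_half _).trans (by norm_num)
        _ = K ^ (b * (d + 1)) := by rw [one_mul, pow_mul]
        _ ≤ _ := hmono (by omega)
    have hM0 : (0 : ℝ) < M := lt_of_le_of_lt (by positivity) hMb
    set g : ℕ → ℝ[X] := fun h => taylor (h : ℝ) f - f with hg
    -- The number of terms left after a shift by `h` is `M - h`; it is comparable with `M` whenever
    -- the shifted sum is large.
    set x : ℕ → ℝ := fun h => ‖∑ m ∈ Finset.range (M - h), ee ((g h).eval (m : ℝ))‖ with hx
    have hxle : ∀ h, x h ≤ (M - h : ℕ) := by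
      intro h
      refine (norm_sum_le _ _).trans ?_
      simp [norm_ee]
    have hvdc := norm_sum_sq_le_sum_shift (fun m => ee (f.eval (m : ℝ))) M
    have hvx : ∀ h, ‖∑ m ∈ Finset.range (M - h), ee (f.eval ((m + h : ℕ) : ℝ)) *
        (starRingEnd ℂ) (ee (f.eval (m : ℝ)))‖ = x h := by
      intro h
      simp only [hx, hg, ← ee_sub, eval_sub, taylor_eval, Nat.cast_add]
    simp only [hvx] at hvdc
    have hsum : 1 / (2 * K ^ 2) * (M : ℝ) ^ 2 ≤ ∑ h ∈ Finset.range M, x h := by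
      have h1 : (M : ℝ) ^ 2 ≤ K ^ 2 * (2 * ∑ h ∈ Finset.range M, x h) := by
        calc (M : ℝ) ^ 2 ≤ (K * ‖∑ m ∈ Finset.range M, ee (f.eval (m : ℝ))‖) ^ 2 := by gcongr
          _ = K ^ 2 * ‖∑ m ∈ Finset.range M, ee (f.eval (m : ℝ))‖ ^ 2 := by ring
          _ ≤ _ := by gcongr
      rw [one_div_mul_eq_div, div_le_iff₀ (by positivity)]
      linarith
    have hcard := card_filter_ge_of_sum_ge (fun h _ => (hxle h).trans
      (by exact_mod_cast Nat.sub_le M h)) (by positivity) hsum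
    set S := (Finset.range M).filter fun h => 1 / (2 * K ^ 2) / 2 * (M : ℝ) ≤ x h with hS
    have hK4 : ∀ y : ℝ, 1 / (2 * K ^ 2) / 2 * (M : ℝ) ≤ y → (M : ℝ) ≤ K ^ 4 * y := by
      intro y hy
      have h1 : (M : ℝ) = 4 * K ^ 2 * (1 / (2 * K ^ 2) / 2 * (M : ℝ)) := by field_simp; norm_num
      have hy0 : 0 ≤ y := le_trans (by positivity) hy
      calc (M : ℝ) = 4 * K ^ 2 * (1 / (2 * K ^ 2) / 2 * (M : ℝ)) := h1
        _ ≤ 4 * K ^ 2 * y := by gcongr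
        _ ≤ K ^ 4 * y := by
          gcongr
          nlinarith [htwo 2, sq_nonneg K]
    have hSx : ∀ h ∈ S, h < M ∧ (M : ℝ) ≤ K ^ 4 * x h := by
      intro h hh
      have := Finset.mem_filter.1 hh
      exact ⟨Finset.mem_range.1 this.1, hK4 _ this.2⟩
    have hScard : (M : ℝ) ≤ K ^ 4 * S.card := hK4 _ hcard
    set a := f.coeff (d + 1) with ha
    have hq : ∀ h ∈ S, ∃ q : ℕ, 1 ≤ q ∧ (q : ℝ) ≤ K ^ (4 * B) ∧
        distInt (q * ((d + 1) * h * a)) * (M : ℝ) ^ d ≤ K ^ (4 * B + 4 * d) := by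
      intro h hh
      obtain ⟨-, hMx⟩ := hSx h hh
      obtain ⟨hgd, hgc⟩ := natDegree_taylor_sub_le hf (h : ℝ)
      have hMh : ((M - h : ℕ) : ℝ) ≤ M := by exact_mod_cast Nat.sub_le M h
      obtain ⟨q, hq1, hqK, hqd⟩ := ih (K ^ 4) (hK.trans (le_self_pow₀ hK1 (by norm_num))) (M - h)
        (g h) hgd (hMh.trans hMx)
      rw [← pow_mul] at hqK hqd
      refine ⟨q, hq1, hqK, ?_⟩
      rw [← hgc]
      have h2 : (M : ℝ) ≤ K ^ 4 * (M - h : ℕ) := hMx.trans (by gcongr; exact hxle h)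
      calc distInt (q * (g h).coeff d) * (M : ℝ) ^ d
          ≤ distInt (q * (g h).coeff d) * (K ^ 4 * (M - h : ℕ)) ^ d := by
            gcongr
            exact distInt_nonneg _
        _ = distInt (q * (g h).coeff d) * ((M - h : ℕ) : ℝ) ^ d * K ^ (4 * d) := by
            rw [mul_pow, ← pow_mul]; ring
        _ ≤ K ^ (4 * B) * K ^ (4 * d) := by gcongr
        _ = K ^ (4 * B + 4 * d) := by rw [pow_add]
    -- One of the at most `K ^ (4 * B)` possible multipliers serves a large set `T` of shifts.
    choose! qf hq1 hqK hqd using hq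
    have hpig : (Finset.Icc 1 ⌊K ^ (4 * B)⌋₊).card • ((S.card : ℝ) / K ^ (4 * B)) ≤ S.card := by
      rw [Nat.card_Icc, Nat.add_sub_cancel, nsmul_eq_mul]
      have h1 : (⌊K ^ (4 * B)⌋₊ : ℝ) ≤ K ^ (4 * B) := Nat.floor_le (by positivity)
      calc (⌊K ^ (4 * B)⌋₊ : ℝ) * ((S.card : ℝ) / K ^ (4 * B))
          ≤ K ^ (4 * B) * ((S.card : ℝ) / K ^ (4 * B)) := by gcongr
        _ = S.card := by field_simp
    obtain ⟨q, hq, hT⟩ := Finset.exists_le_card_fiber_of_nsmul_le_card_of_maps_to (f := qf)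
      (fun h hh => Finset.mem_Icc.2 ⟨hq1 h hh, Nat.le_floor (hqK h hh)⟩)
      (Finset.nonempty_Icc.2 (Nat.le_floor (by simpa using one_le_pow₀ hK1))) hpig
    obtain ⟨hq1', hqK'⟩ := Finset.mem_Icc.1 hq
    have hqK'' : (q : ℝ) ≤ K ^ (4 * B) := (Nat.le_floor_iff (by positivity)).1 hqK'
    set T := S.filter fun h => qf h = q with hTdef
    set K₁ := K ^ (4 + 4 * B) with hK₁
    have hTcard : (M : ℝ) ≤ K₁ * T.card := by
      rw [div_le_iff₀ (by positivity)] at hT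
      calc (M : ℝ) ≤ K ^ 4 * S.card := hScard
        _ ≤ K ^ 4 * (T.card * K ^ (4 * B)) := by gcongr
        _ = K₁ * T.card := by rw [hK₁, pow_add]; ring
    set ε := K ^ (4 * B + 4 * d) / (M : ℝ) ^ d with hε
    have hTθ : ∀ h ∈ T, distInt (h * (q * (d + 1) * a)) ≤ ε := by
      intro h hh
      obtain ⟨hhS, hhq⟩ := Finset.mem_filter.1 hh
      rw [hε, le_div_iff₀ (by positivity)]
      have := hqd h hhS
      rw [hhq] at this
      rwa [show (h : ℝ) * (q * (d + 1) * a) = q * ((d + 1) * h * a) by ring]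
    have hMd : (M : ℝ) ≤ (M : ℝ) ^ d :=
      le_self_pow₀ ((one_le_pow₀ hK1).trans hMb.le) (by omega)
    obtain ⟨r, hr1, hrK, hr⟩ := exists_distInt_mul_le_of_dense (K := K₁) (ε := ε)
      (θ := q * (d + 1) * a) (S := T) (hK.trans (le_self_pow₀ hK1 (by omega)))
      (fun h hh => Finset.mem_range.2 (hSx h (Finset.mem_filter.1 hh).1).1) hTcard hTθ
      (by
        calc 16 * K₁ ^ 2 = 2 ^ 4 * K₁ ^ 2 := by norm_num
          _ ≤ K ^ 4 * K₁ ^ 2 := by gcongr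
          _ = K ^ (12 + 8 * B) := by rw [hK₁]; ring
          _ ≤ K ^ b := hmono (by omega)
          _ ≤ M := hMb.le)
      (by
        rw [hε, ← mul_div_assoc, div_lt_one (by positivity)]
        calc 128 * K₁ * K ^ (4 * B + 4 * d) = 2 ^ 7 * K₁ * K ^ (4 * B + 4 * d) := by norm_num
          _ ≤ K ^ 7 * K₁ * K ^ (4 * B + 4 * d) := by gcongr
          _ = K ^ (11 + 8 * B + 4 * d) := by rw [hK₁]; ring
          _ ≤ K ^ b := hmono (by omega)
          _ < M := hMb
          _ ≤ (M : ℝ) ^ d := hMd)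
    refine ⟨r * q * (d + 1), ?_, ?_, ?_⟩
    · exact Nat.succ_le_of_lt (by positivity)
    · push_cast
      calc (r : ℝ) * q * (d + 1) ≤ (2 * K₁) * K ^ (4 * B) * K ^ (d + 1) := by
            gcongr
            exact_mod_cast natCast_le_pow hK (d + 1)
        _ ≤ (K * K₁) * K ^ (4 * B) * K ^ (d + 1) := by gcongr
        _ = K ^ (6 + 8 * B + d) := by rw [hK₁]; ring
        _ ≤ _ := hmono (by omega)
    · have h1 : ((r * q * (d + 1) : ℕ) : ℝ) * a = r * (q * (d + 1) * a) := by push_cast; ring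
      rw [h1, pow_succ']
      calc distInt (r * (q * (d + 1) * a)) * (M * (M : ℝ) ^ d)
          = distInt (r * (q * (d + 1) * a)) * M * (M : ℝ) ^ d := by ring
        _ ≤ 16 * K₁ ^ 2 * ε * (M : ℝ) ^ d := by gcongr
        _ = 2 ^ 4 * K₁ ^ 2 * K ^ (4 * B + 4 * d) := by rw [hε]; field_simp; ring
        _ ≤ K ^ 4 * K₁ ^ 2 * K ^ (4 * B + 4 * d) := by gcongr
        _ = K ^ (12 + 12 * B + 4 * d) := by rw [hK₁]; ring
        _ ≤ _ := hmono (by omega)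

end

/-! ### Averaging a weighted sum along a direction -/

section Averaging

variable {G : Type*} [AddCommGroup G]

/-- The total variation of `w` in the direction `h`. It is used for finitely supported `w`. -/
noncomputable def variation (w : G → ℂ) (h : G) : ℝ := ∑' n, ‖w (n + h) - w n‖

theorem finite_support_shift {w : G → ℂ} (hw : w.support.Finite) (h : G) :
    (fun n => w (n + h)).support.Finite :=
  hw.preimage (f := fun n => n + h) (add_left_injective h).injOn

theorem summable_shift_sub {w : G → ℂ} (hw : w.support.Finite) (h h' : G) :
    Summable fun n => ‖w (n + h) - w (n + h')‖ := by
  refine summable_of_hasFiniteSupport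
    (((finite_support_shift hw h).union (finite_support_shift hw h')).subset fun n hn => ?_)
  by_contra hcon
  simp only [Set.mem_union, Function.mem_support, not_or, not_not] at hcon
  simp [hcon.1, hcon.2] at hn

theorem variation_nonneg (w : G → ℂ) (h : G) : 0 ≤ variation w h :=
  tsum_nonneg fun _ => norm_nonneg _

theorem variation_zero (w : G → ℂ) : variation w 0 = 0 := by simp [variation]

theorem variation_add_le {w : G → ℂ} (hw : w.support.Finite) (h h' : G) :
    variation w (h + h') ≤ variation w h + variation w h' := by
  have h1 : variation w h = ∑' n, ‖w (n + (h + h')) - w (n + h')‖ := by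
    rw [variation, ← (Equiv.addRight h').tsum_eq]
    simp [add_right_comm, add_assoc, add_comm h h']
  have s1 := summable_shift_sub hw (h + h') h'
  have s2 : Summable fun n => ‖w (n + h') - w n‖ := by simpa using summable_shift_sub hw h' 0
  have s3 : Summable fun n => ‖w (n + (h + h')) - w n‖ := by
    simpa using summable_shift_sub hw (h + h') 0
  rw [h1, variation, variation, ← s1.tsum_add s2]
  refine s3.tsum_le_tsum (fun n => ?_) (s1.add s2)
  exact norm_sub_le_norm_sub_add_norm_sub _ _ _

theorem variation_sum_le {ι : Type*} {w : G → ℂ} (hw : w.support.Finite) (s : Finset ι)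
    (h : ι → G) : variation w (∑ i ∈ s, h i) ≤ ∑ i ∈ s, variation w (h i) :=
  Finset.le_sum_of_subadditive _ (variation_zero w).le (variation_add_le hw) s h

theorem variation_nsmul_le {w : G → ℂ} (hw : w.support.Finite) (m : ℕ) (h : G) :
    variation w (m • h) ≤ m * variation w h := by
  have := variation_sum_le hw (Finset.range m) fun _ => h
  simpa using this

/-- A weighted sum of unimodular terms is controlled by its averages along progressions of
difference `h`, up to the variation of the weight in the direction `h`. -/
theorem mul_norm_tsum_le {w u : G → ℂ} (hw : w.support.Finite) (hu : ∀ n, ‖u n‖ ≤ 1)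
    (h : G) (m : ℕ) :
    m * ‖∑' n, u n * w n‖ ≤
      ∑' n, ‖w n‖ * ‖∑ i ∈ Finset.range m, u (n + i • h)‖ + (m : ℝ) ^ 2 * variation w h := by
  have hsh : ∀ g : G, (fun n => u (n + g) * w (n + g)).support.Finite := fun g =>
    (finite_support_shift hw g).subset fun n hn => right_ne_zero_of_mul hn
  have hmain : (m : ℂ) * ∑' n, u n * w n =
      ∑' n, ∑ i ∈ Finset.range m, u (n + i • h) * w (n + i • h) := by
    rw [Summable.tsum_finsetSum fun i _ => summable_of_hasFiniteSupport (hsh _)]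
    have : ∀ i ∈ Finset.range m, ∑' n, u (n + i • h) * w (n + i • h) = ∑' n, u n * w n :=
      fun i _ => (Equiv.addRight (i • h)).tsum_eq fun n => u n * w n
    rw [Finset.sum_congr rfl this]
    simp
  have s1 : Summable fun n => ‖∑ i ∈ Finset.range m, u (n + i • h) * w (n + i • h)‖ := by
    refine summable_of_hasFiniteSupport
      (((Finset.range m).finite_toSet.biUnion fun i _ => hsh (i • h)).subset fun n hn => ?_)
    by_contra hcon
    simp only [Set.mem_iUnion, Function.mem_support, not_exists, not_not] at hcon
    exact hn (norm_eq_zero.2 (Finset.sum_eq_zero fun i hi => hcon i hi))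
  have s2 : Summable fun n => ‖w n‖ * ‖∑ i ∈ Finset.range m, u (n + i • h)‖ :=
    summable_of_hasFiniteSupport (hw.subset fun n hn => norm_ne_zero_iff.1 (left_ne_zero_of_mul hn))
  have s3 : ∀ i : ℕ, Summable fun n => ‖w (n + i • h) - w n‖ := fun i => by
    simpa using summable_shift_sub hw (i • h) 0
  have s4 : Summable fun n => ∑ i ∈ Finset.range m, ‖w (n + i • h) - w n‖ :=
    summable_sum fun i _ => s3 i
  calc m * ‖∑' n, u n * w n‖ = ‖(m : ℂ) * ∑' n, u n * w n‖ := by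
        rw [norm_mul, Complex.norm_natCast]
    _ ≤ ∑' n, ‖∑ i ∈ Finset.range m, u (n + i • h) * w (n + i • h)‖ := by
        rw [hmain]
        exact norm_tsum_le_tsum_norm s1
    _ ≤ ∑' n, (‖w n‖ * ‖∑ i ∈ Finset.range m, u (n + i • h)‖ +
          ∑ i ∈ Finset.range m, ‖w (n + i • h) - w n‖) := by
        refine s1.tsum_le_tsum (fun n => ?_) (s2.add s4)
        have : ∑ i ∈ Finset.range m, u (n + i • h) * w (n + i • h) =
            w n * ∑ i ∈ Finset.range m, u (n + i • h) +
            ∑ i ∈ Finset.range m, u (n + i • h) * (w (n + i • h) - w n) := by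
          rw [Finset.mul_sum, ← Finset.sum_add_distrib]
          exact Finset.sum_congr rfl fun i _ => by ring
        rw [this]
        refine (norm_add_le _ _).trans ?_
        rw [norm_mul]
        gcongr
        refine (norm_sum_le _ _).trans (Finset.sum_le_sum fun i _ => ?_)
        rw [norm_mul]
        exact mul_le_of_le_one_left (norm_nonneg _) (hu _)
    _ = ∑' n, ‖w n‖ * ‖∑ i ∈ Finset.range m, u (n + i • h)‖ +
          ∑ i ∈ Finset.range m, variation w (i • h) := by
        rw [s2.tsum_add s4, Summable.tsum_finsetSum fun i _ => s3 i]
        rfl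
    _ ≤ _ := by
        gcongr
        calc ∑ i ∈ Finset.range m, variation w (i • h)
            ≤ ∑ i ∈ Finset.range m, m * variation w h := by
              refine Finset.sum_le_sum fun i hi => (variation_nsmul_le hw i h).trans ?_
              gcongr
              · exact variation_nonneg w h
              · exact (Finset.mem_range.1 hi).le
          _ = (m : ℝ) ^ 2 * variation w h := by simp; ring

end Averaging

/-! ### Polynomials in several variables along lines -/

section

open Polynomial

/-- The multi-indices in `{0, …, d}^k`. The same set serves as the grid of directions `h` along
which a polynomial is sampled. -/
def indexGrid (k d : ℕ) : Finset (Fin k → ℕ) := Fintype.piFinset fun _ => Finset.range (d + 1)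

theorem mem_indexGrid {k d : ℕ} {γ : Fin k → ℕ} : γ ∈ indexGrid k d ↔ ∀ i, γ i ≤ d := by
  simp [indexGrid]

theorem card_indexGrid (k d : ℕ) : (indexGrid k d).card = (d + 1) ^ k := by
  simp [indexGrid]

theorem sum_le_of_mem_indexGrid {k d : ℕ} {γ : Fin k → ℕ} (hγ : γ ∈ indexGrid k d) :
    ∑ i, γ i ≤ k * d := by
  have := Finset.sum_le_card_nsmul Finset.univ γ d fun i _ => mem_indexGrid.1 hγ i
  simpa using this

/-- The form of degree `j` in a polynomial with coefficients `ξ`, evaluated at `h`. -/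
noncomputable def formPart {k : ℕ} (d j : ℕ) (ξ : (Fin k → ℕ) → ℝ) (h : Fin k → ℕ) : ℝ :=
  ∑ γ ∈ (indexGrid k d).filter (fun γ => ∑ i, γ i = j), ξ γ * ∏ i, (h i : ℝ) ^ γ i

/-- Alternating binomial sums of powers: the `n`-th difference at `0` of `x ↦ x ^ m` for `m ≤ n`. -/
theorem sum_neg_one_pow_choose_mul_pow {m n : ℕ} (hmn : m ≤ n) :
    ∑ j ∈ Finset.range (n + 1), ((-1 : ℝ) ^ (n - j) * n.choose j) * (j : ℝ) ^ m =
      if m = n then (n.factorial : ℝ) else 0 := by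
  have h := fwdDiff_iter_eq_sum_shift (1 : ℝ) (fun r : ℝ => r ^ m) n 0
  simp only [zero_add, nsmul_eq_mul, mul_one, zsmul_eq_mul] at h
  push_cast at h
  rw [← h]
  split_ifs with hm
  · subst hm
    rw [fwdDiff_iter_eq_factorial]
    simp
  · rw [fwdDiff_iter_pow_eq_zero_of_lt (lt_of_le_of_ne hmn hm)]
    simp

/-- The coefficients of a form are recovered from its values on the grid by iterated differences. -/
theorem sum_choose_mul_formPart {k d : ℕ} (ξ : (Fin k → ℕ) → ℝ) {γ : Fin k → ℕ}
    (hγ : γ ∈ indexGrid k d) :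
    ∑ h ∈ Fintype.piFinset (fun i => Finset.range (γ i + 1)),
      (∏ i, ((-1 : ℝ) ^ (γ i - h i) * (γ i).choose (h i))) * formPart d (∑ i, γ i) ξ h =
      (∏ i, ((γ i).factorial : ℝ)) * ξ γ := by
  simp only [formPart, Finset.mul_sum]
  rw [Finset.sum_comm]
  have hinner : ∀ γ' : Fin k → ℕ,
      ∑ h ∈ Fintype.piFinset (fun i => Finset.range (γ i + 1)),
        (∏ i, ((-1 : ℝ) ^ (γ i - h i) * (γ i).choose (h i))) * (ξ γ' * ∏ i, (h i : ℝ) ^ γ' i) =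
      ξ γ' * ∏ i, ∑ j ∈ Finset.range (γ i + 1),
        ((-1 : ℝ) ^ (γ i - j) * (γ i).choose j) * (j : ℝ) ^ γ' i := by
    intro γ'
    rw [Finset.prod_univ_sum, Finset.mul_sum]
    refine Finset.sum_congr rfl fun h _ => ?_
    rw [Finset.prod_mul_distrib (f := fun i => (-1 : ℝ) ^ (γ i - h i) * (γ i).choose (h i))]
    ring
  simp only [hinner]
  rw [Finset.sum_eq_single γ]
  · rw [mul_comm]
    congr 1
    refine Finset.prod_congr rfl fun i _ => ?_
    rw [sum_neg_one_pow_choose_mul_pow le_rfl, if_pos rfl]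
  · intro γ' hγ' hne
    have hsum := (Finset.mem_filter.1 hγ').2
    obtain ⟨i, hi⟩ : ∃ i, γ' i < γ i := by
      by_contra! hcon
      exact hne (funext fun i =>
        ((Finset.sum_eq_sum_iff_of_le fun i _ => hcon i).1 hsum.symm i (Finset.mem_univ i)).symm)
    rw [Finset.prod_eq_zero (Finset.mem_univ i), mul_zero]
    rw [sum_neg_one_pow_choose_mul_pow hi.le, if_neg hi.ne]
  · intro hcon
    simp [hγ] at hcon

/-- The restriction of a polynomial with coefficients `ξ`, indexed by `Γ`, to the line
`t ↦ n + t H`. -/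
noncomputable def linePoly {k : ℕ} (Γ : Finset (Fin k → ℕ)) (ξ : (Fin k → ℕ) → ℝ)
    (n H : Fin k → ℤ) : ℝ[X] :=
  ∑ γ ∈ Γ, C (ξ γ) * ∏ i, (C (n i : ℝ) + C (H i : ℝ) * X) ^ γ i

theorem eval_linePoly {k : ℕ} (Γ : Finset (Fin k → ℕ)) (ξ : (Fin k → ℕ) → ℝ)
    (n H : Fin k → ℤ) (m : ℕ) :
    (linePoly Γ ξ n H).eval (m : ℝ) = ∑ γ ∈ Γ, ξ γ * ∏ i, (((n + m • H) i : ℤ) : ℝ) ^ γ i := by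
  simp only [linePoly, eval_finsetSum, eval_mul, eval_C, eval_prod, eval_pow, eval_add, eval_X]
  refine Finset.sum_congr rfl fun γ _ => ?_
  simp [mul_comm]

theorem natDegree_C_add_C_mul_X_le (a b : ℝ) : (C a + C b * X).natDegree ≤ 1 := by
  rw [add_comm]; exact natDegree_linear_le

theorem natDegree_coeff_prod_pow_linear {ι : Type*} (s : Finset ι) (a b : ι → ℝ) (γ : ι → ℕ) :
    (∏ i ∈ s, (C (a i) + C (b i) * X) ^ γ i).natDegree ≤ ∑ i ∈ s, γ i ∧
      (∏ i ∈ s, (C (a i) + C (b i) * X) ^ γ i).coeff (∑ i ∈ s, γ i) = ∏ i ∈ s, b i ^ γ i := by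
  classical
  induction s using Finset.induction_on with
  | empty => simp
  | insert i s hi ih =>
    have h1 : ((C (a i) + C (b i) * X) ^ γ i).natDegree ≤ γ i := by
      simpa using natDegree_pow_le_of_le (γ i) (natDegree_C_add_C_mul_X_le (a i) (b i))
    rw [Finset.prod_insert hi, Finset.sum_insert hi, Finset.prod_insert hi]
    refine ⟨natDegree_mul_le_of_le h1 ih.1, ?_⟩
    rw [coeff_mul_add_eq_of_natDegree_le h1 ih.1, ih.2]
    congr 1
    have := coeff_pow_of_natDegree_le (m := γ i) (natDegree_C_add_C_mul_X_le (a i) (b i))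
    rw [mul_one] at this
    simpa using this

theorem natDegree_linePoly_le {k : ℕ} {Γ : Finset (Fin k → ℕ)} {j : ℕ}
    (hΓ : ∀ γ ∈ Γ, ∑ i, γ i ≤ j) (ξ : (Fin k → ℕ) → ℝ) (n H : Fin k → ℤ) :
    (linePoly Γ ξ n H).natDegree ≤ j := by
  refine natDegree_sum_le_of_forall_le _ _ fun γ hγ => ?_
  refine (natDegree_C_mul_le _ _).trans ?_
  exact (natDegree_coeff_prod_pow_linear Finset.univ _ _ γ).1.trans (hΓ γ hγ)

/-- Along a line of direction `q h`, the coefficient of degree `j` of a polynomial of degree at most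
`j` does not depend on the base point: it is the form of degree `j` at `q h`. -/
theorem coeff_linePoly {k d j : ℕ} (ξ : (Fin k → ℕ) → ℝ) (n : Fin k → ℤ) (q : ℕ)
    (h : Fin k → ℕ) :
    (linePoly ((indexGrid k d).filter fun γ => ∑ i, γ i ≤ j) ξ n
      (fun i => (q : ℤ) * h i)).coeff j = (q : ℝ) ^ j * formPart d j ξ h := by
  simp only [linePoly, finsetSum_coeff, coeff_C_mul, formPart, Finset.mul_sum]
  rw [← Finset.sum_filter_add_sum_filter_not _ (fun γ : Fin k → ℕ => ∑ i, γ i = j)]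
  rw [Finset.filter_filter, Finset.filter_filter]
  have h1 : (indexGrid k d).filter (fun γ => ∑ i, γ i ≤ j ∧ ∑ i, γ i = j) =
      (indexGrid k d).filter (fun γ => ∑ i, γ i = j) :=
    Finset.filter_congr fun γ _ => ⟨fun h => h.2, fun h => ⟨h.le, h⟩⟩
  rw [h1]
  have h2 : ∀ γ ∈ (indexGrid k d).filter (fun γ => ∑ i, γ i ≤ j ∧ ¬ ∑ i, γ i = j),
      ξ γ * (∏ i, (C (n i : ℝ) + C (((q : ℤ) * h i : ℤ) : ℝ) * X) ^ γ i).coeff j = 0 := by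
    intro γ hγ
    have := (Finset.mem_filter.1 hγ).2
    rw [coeff_eq_zero_of_natDegree_lt, mul_zero]
    exact lt_of_le_of_lt (natDegree_coeff_prod_pow_linear Finset.univ _ _ γ).1
      (lt_of_le_of_ne this.1 this.2)
  rw [Finset.sum_eq_zero h2, add_zero]
  refine Finset.sum_congr rfl fun γ hγ => ?_
  have hj := (Finset.mem_filter.1 hγ).2
  have := (natDegree_coeff_prod_pow_linear Finset.univ (fun i => (n i : ℝ))
    (fun i => (((q : ℤ) * h i : ℤ) : ℝ)) γ).2
  rw [hj] at this
  rw [this]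
  push_cast
  simp only [mul_pow]
  rw [Finset.prod_mul_distrib, Finset.prod_pow_eq_pow_sum, hj]
  ring

/-- Monomials vary slowly. -/
theorem abs_prod_pow_sub_prod_pow_mul_le {ι : Type*} (s : Finset ι) (x y : ι → ℝ) (γ : ι → ℕ)
    {Y D : ℝ} (hx : ∀ i, |x i| ≤ Y) (hy : ∀ i, |y i| ≤ Y) (hxy : ∀ i, |x i - y i| ≤ D)
    (hY : 0 ≤ Y) (hD : 0 ≤ D) :
    |∏ i ∈ s, x i ^ γ i - ∏ i ∈ s, y i ^ γ i| * Y ≤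
      ((∑ i ∈ s, γ i : ℕ) : ℝ) * Y ^ (∑ i ∈ s, γ i) * D := by
  classical
  have hpow : ∀ (i : ι) (n : ℕ), |x i ^ n - y i ^ n| * Y ≤ n * Y ^ n * D := by
    intro i n
    induction n with
    | zero => simp
    | succ n ih =>
      have h1 : x i ^ (n + 1) - y i ^ (n + 1) = x i * (x i ^ n - y i ^ n) + (x i - y i) * y i ^ n := by
        ring
      have h2 : |y i ^ n| ≤ Y ^ n := by
        rw [abs_pow]; exact pow_le_pow_left₀ (abs_nonneg _) (hy i) n
      calc |x i ^ (n + 1) - y i ^ (n + 1)| * Y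
          ≤ (|x i| * |x i ^ n - y i ^ n| + |x i - y i| * |y i ^ n|) * Y := by
            rw [h1, ← abs_mul, ← abs_mul]
            gcongr
            exact abs_add_le _ _
        _ = |x i| * (|x i ^ n - y i ^ n| * Y) + |x i - y i| * |y i ^ n| * Y := by ring
        _ ≤ Y * (n * Y ^ n * D) + D * Y ^ n * Y := by
            gcongr
            · exact hx i
            · exact hxy i
        _ = ((n + 1 : ℕ) : ℝ) * Y ^ (n + 1) * D := by push_cast; ring
  induction s using Finset.induction_on with
  | empty => simp
  | insert i s hi ih =>
    rw [Finset.prod_insert hi, Finset.prod_insert hi, Finset.sum_insert hi]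
    set P := ∏ i ∈ s, x i ^ γ i
    set Q := ∏ i ∈ s, y i ^ γ i with hQ
    have h1 : x i ^ γ i * P - y i ^ γ i * Q = x i ^ γ i * (P - Q) + (x i ^ γ i - y i ^ γ i) * Q := by
      ring
    have h2 : |x i ^ γ i| ≤ Y ^ γ i := by
      rw [abs_pow]; exact pow_le_pow_left₀ (abs_nonneg _) (hx i) _
    have h3 : |Q| ≤ Y ^ (∑ i ∈ s, γ i) := by
      rw [hQ, Finset.abs_prod, ← Finset.prod_pow_eq_pow_sum]
      refine Finset.prod_le_prod (fun _ _ => abs_nonneg _) fun i _ => ?_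
      rw [abs_pow]; exact pow_le_pow_left₀ (abs_nonneg _) (hy i) _
    calc |x i ^ γ i * P - y i ^ γ i * Q| * Y
        ≤ (|x i ^ γ i| * |P - Q| + |x i ^ γ i - y i ^ γ i| * |Q|) * Y := by
          rw [h1, ← abs_mul, ← abs_mul]
          gcongr
          exact abs_add_le _ _
      _ = |x i ^ γ i| * (|P - Q| * Y) + |x i ^ γ i - y i ^ γ i| * Y * |Q| := by ring
      _ ≤ Y ^ γ i * (((∑ i ∈ s, γ i : ℕ) : ℝ) * Y ^ (∑ i ∈ s, γ i) * D) +
          (γ i * Y ^ γ i * D) * Y ^ (∑ i ∈ s, γ i) := by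
          refine add_le_add (mul_le_mul h2 ih (by positivity) (by positivity))
            (mul_le_mul (hpow i (γ i)) h3 (abs_nonneg _) (by positivity))
      _ = _ := by push_cast; ring

theorem dvd_prod_pow_sub_prod_pow {k : ℕ} (n H : Fin k → ℤ) (γ : Fin k → ℕ) {q : ℤ}
    (hH : ∀ i, q ∣ H i) (m : ℕ) : q ∣ ∏ i, (n + m • H) i ^ γ i - ∏ i, n i ^ γ i := by
  rw [← Int.modEq_iff_dvd]
  refine Int.ModEq.prod fun i _ => Int.ModEq.pow _ ?_
  rw [Int.modEq_iff_dvd]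
  simpa using (hH i).mul_left (m : ℤ)

/-! ### Lattice boxes -/

/-- The lattice points of sup norm at most `X`. -/
noncomputable def latticeBox (k : ℕ) (X : ℝ) : Finset (Fin k → ℤ) :=
  Fintype.piFinset fun _ => Finset.Icc (-⌊X⌋) ⌊X⌋

theorem mem_Icc_floor {X : ℝ} {m : ℤ} : m ∈ Finset.Icc (-⌊X⌋) ⌊X⌋ ↔ |(m : ℝ)| ≤ X := by
  rw [Finset.mem_Icc, ← abs_le, Int.le_floor]
  simp

theorem mem_latticeBox {k : ℕ} {X : ℝ} {n : Fin k → ℤ} :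
    n ∈ latticeBox k X ↔ ∀ i, |(n i : ℝ)| ≤ X := by
  simp only [latticeBox, Fintype.mem_piFinset, mem_Icc_floor]

theorem card_Icc_floor_le {X : ℝ} (hX : 1 ≤ X) :
    ((Finset.Icc (-⌊X⌋) ⌊X⌋).card : ℝ) ≤ 3 * X := by
  have h0 : 0 ≤ ⌊X⌋ := Int.floor_nonneg.2 (by linarith)
  rw [Int.card_Icc]
  have h1 : ((⌊X⌋ + 1 - -⌊X⌋).toNat : ℤ) = 2 * ⌊X⌋ + 1 := by omega
  have h2 : ((⌊X⌋ + 1 - -⌊X⌋).toNat : ℝ) = 2 * ⌊X⌋ + 1 := by exact_mod_cast h1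
  rw [h2]
  have := Int.floor_le X
  linarith

theorem card_latticeBox_le (k : ℕ) {X : ℝ} (hX : 1 ≤ X) :
    ((latticeBox k X).card : ℝ) ≤ (3 * X) ^ k := by
  rw [latticeBox, Fintype.card_piFinset_const]
  push_cast
  exact pow_le_pow_left₀ (Nat.cast_nonneg _) (card_Icc_floor_le hX) k

end

/-! ### The inverse theorem for weighted sums in several variables -/

section

open Polynomial

/-- A polynomial with coefficients `ξ` indexed by the grid of multi-indices, on `ℤ^k`. -/
noncomputable def gridPoly {k : ℕ} (d : ℕ) (ξ : (Fin k → ℕ) → ℝ) (n : Fin k → ℤ) : ℝ :=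
  ∑ γ ∈ indexGrid k d, ξ γ * ∏ i, (n i : ℝ) ^ γ i

/-- The weighted exponential sum over the box of size `X` with coefficients `ξ` and weight `w` is
large: it loses at most a factor `K` over the trivial bound, while `w` is bounded by `1` and has
total variation at most `K X^{k-1}` in each coordinate direction. -/
structure IsLargeSum {k : ℕ} (d : ℕ) (K X : ℝ) (ξ : (Fin k → ℕ) → ℝ) (w : (Fin k → ℤ) → ℂ) :
    Prop where
  norm_le : ∀ n, ‖w n‖ ≤ 1
  mem_box : ∀ n, w n ≠ 0 → n ∈ latticeBox k X
  variation_le : ∀ i, variation w (Pi.single i 1) * X ≤ K * X ^ k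
  le_norm : X ^ k ≤ K * ‖∑' n, ee (gridPoly d ξ n) * w n‖

theorem IsLargeSum.finite_support {k d : ℕ} {K X : ℝ} {ξ : (Fin k → ℕ) → ℝ}
    {w : (Fin k → ℤ) → ℂ} (h : IsLargeSum d K X ξ w) : w.support.Finite :=
  (latticeBox k X).finite_toSet.subset fun n hn => h.mem_box n hn

theorem IsLargeSum.variation_mul_le {k d : ℕ} {K X : ℝ} {ξ : (Fin k → ℕ) → ℝ}
    {w : (Fin k → ℤ) → ℂ} (hL : IsLargeSum d K X ξ w) (hX : 0 ≤ X) (q : ℕ) {h : Fin k → ℕ}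
    (hh : h ∈ indexGrid k d) :
    variation w (fun i => (q : ℤ) * h i) * X ≤ q * (k * d) * (K * X ^ k) := by
  have h1 : (fun i => (q : ℤ) * h i) = ∑ i, (q * h i) • (Pi.single i 1 : Fin k → ℤ) := by
    funext j
    simp [Finset.sum_apply, Pi.single_apply]
  have hv : ∀ i, 0 ≤ variation w (Pi.single i 1) := fun i => variation_nonneg _ _
  rw [h1]
  calc variation w (∑ i, (q * h i) • (Pi.single i 1 : Fin k → ℤ)) * X
      ≤ (∑ i, ((q * h i : ℕ) : ℝ) * variation w (Pi.single i 1)) * X := by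
        gcongr
        refine (variation_sum_le hL.finite_support _ _).trans (Finset.sum_le_sum fun i _ => ?_)
        exact variation_nsmul_le hL.finite_support _ _
    _ = ∑ i, ((q * h i : ℕ) : ℝ) * (variation w (Pi.single i 1) * X) := by
        rw [Finset.sum_mul]
        exact Finset.sum_congr rfl fun i _ => by ring
    _ ≤ ∑ _i : Fin k, ((q * d : ℕ) : ℝ) * (K * X ^ k) := by
        refine Finset.sum_le_sum fun i _ => ?_
        have h3 := hL.variation_le i
        have h4 : ((q * h i : ℕ) : ℝ) ≤ ((q * d : ℕ) : ℝ) := by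
          exact_mod_cast Nat.mul_le_mul_left q (mem_indexGrid.1 hh i)
        exact mul_le_mul h4 h3 (mul_nonneg (hv i) hX) (Nat.cast_nonneg _)
    _ = q * (k * d) * (K * X ^ k) := by simp; ring

/-- Some progression of difference `q h` and length `M` starting in the box carries a large
unweighted exponential sum. -/
theorem IsLargeSum.exists_line {k d : ℕ} {K X : ℝ} {ξ : (Fin k → ℕ) → ℝ}
    {w : (Fin k → ℤ) → ℂ} (hL : IsLargeSum d K X ξ w) (hK : 0 < K) (hX : 1 ≤ X) (q : ℕ)
    {h : Fin k → ℕ} (hh : h ∈ indexGrid k d) {M : ℕ} (hM : 1 ≤ M)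
    (hMX : 2 * K ^ 2 * q * (k * d) * M ≤ X) :
    ∃ n ∈ latticeBox k X, (M : ℝ) ≤ 3 ^ (k + 1) * K *
      ‖∑ m ∈ Finset.range M, ee (gridPoly d ξ (n + m • fun i => (q : ℤ) * h i))‖ := by
  set H : Fin k → ℤ := fun i => (q : ℤ) * h i with hH
  set T : (Fin k → ℤ) → ℝ := fun n => ‖∑ m ∈ Finset.range M, ee (gridPoly d ξ (n + m • H))‖ with hT
  have hM0 : (0 : ℝ) < M := by exact_mod_cast hM
  have hX0 : 0 < X := by linarith
  by_contra! hcon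
  have hcon' : ∀ n ∈ latticeBox k X, T n ≤ M / (3 ^ (k + 1) * K) := by
    intro n hn
    rw [le_div_iff₀ (by positivity)]
    have := hcon n hn
    linarith
  have hA := mul_norm_tsum_le (u := fun n => ee (gridPoly d ξ n)) hL.finite_support
    (fun n => (norm_ee _).le) H M
  have hsum : ∑' n, ‖w n‖ * T n ≤ (3 * X) ^ k * (M / (3 ^ (k + 1) * K)) := by
    rw [tsum_eq_sum (s := latticeBox k X) fun n hn => by
      have : w n = 0 := by
        by_contra hne
        exact hn (hL.mem_box n hne)
      simp [this]]
    calc ∑ n ∈ latticeBox k X, ‖w n‖ * T n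
        ≤ ∑ n ∈ latticeBox k X, 1 * (M / (3 ^ (k + 1) * K)) := by
          refine Finset.sum_le_sum fun n hn => ?_
          exact mul_le_mul (hL.norm_le n) (hcon' n hn) (norm_nonneg _) zero_le_one
      _ = (latticeBox k X).card * (M / (3 ^ (k + 1) * K)) := by simp
      _ ≤ _ := by
          gcongr
          exact card_latticeBox_le k hX
  have hV : K * ((M : ℝ) ^ 2 * variation w H) ≤ M * X ^ k / 2 := by
    have h1 := hL.variation_mul_le hX0.le q hh
    have h2 : K * ((M : ℝ) ^ 2 * variation w H) * X ≤ M * X ^ k / 2 * X := by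
      calc K * ((M : ℝ) ^ 2 * variation w H) * X = K * (M : ℝ) ^ 2 * (variation w H * X) := by ring
        _ ≤ K * (M : ℝ) ^ 2 * (q * (k * d) * (K * X ^ k)) := by gcongr
        _ = M * X ^ k / 2 * (2 * K ^ 2 * q * (k * d) * M) := by ring
        _ ≤ M * X ^ k / 2 * X := by gcongr
    exact le_of_mul_le_mul_right h2 hX0
  have hfin : (M : ℝ) * X ^ k ≤ M * X ^ k / 3 + M * X ^ k / 2 := by
    calc (M : ℝ) * X ^ k ≤ M * (K * ‖∑' n, ee (gridPoly d ξ n) * w n‖) := by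
          gcongr
          exact hL.le_norm
      _ = K * (M * ‖∑' n, ee (gridPoly d ξ n) * w n‖) := by ring
      _ ≤ K * ((3 * X) ^ k * (M / (3 ^ (k + 1) * K)) + (M : ℝ) ^ 2 * variation w H) := by
          gcongr
          exact hA.trans (by gcongr)
      _ = M * X ^ k / 3 + K * ((M : ℝ) ^ 2 * variation w H) := by
          rw [mul_pow, pow_succ]
          field_simp
      _ ≤ _ := by gcongr
  have : 0 < (M : ℝ) * X ^ k := by positivity
  linarith

/-- If `qξ_γ` is close to an integer, then along a progression whose difference is divisible by `q`
the monomial `ξ_γ x^γ` is, modulo `1`, constant up to a slowly varying error. -/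
theorem exists_int_abs_monomial_sub_le {k : ℕ} {γ : Fin k → ℕ} {ξ ε X D : ℝ} {q : ℕ} (hq : 1 ≤ q)
    (hξ : distInt (q * ξ) * X ^ (∑ i, γ i) ≤ ε) (hX : 1 ≤ X) (n H : Fin k → ℤ) (m : ℕ)
    (hdvd : ∀ i, (q : ℤ) ∣ H i) (hn : n ∈ latticeBox k X)
    (hHD : ∀ i, m * |(H i : ℝ)| ≤ q * D) (hDX : q * D ≤ X) (hD : 0 ≤ D) :
    ∃ z : ℤ, |ξ * ∏ i, (((n + m • H) i : ℤ) : ℝ) ^ γ i - ξ * ∏ i, (n i : ℝ) ^ γ i - z| * X ≤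
      ε * (((∑ i, γ i : ℕ) : ℝ) * 2 ^ (∑ i, γ i) * D) := by
  obtain ⟨c, hc⟩ := dvd_prod_pow_sub_prod_pow n H γ hdvd m
  have hq0 : (0 : ℝ) < q := by exact_mod_cast hq
  have hX0 : 0 < X := by linarith
  set P := ∏ i, (((n + m • H) i : ℤ) : ℝ) ^ γ i with hP
  set Q := ∏ i, (n i : ℝ) ^ γ i with hQ
  have hPQ : P - Q = q * c := by
    rw [hP, hQ]
    exact_mod_cast hc
  have hxy : ∀ i, |(((n + m • H) i : ℤ) : ℝ) - n i| ≤ q * D := by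
    intro i
    have : (((n + m • H) i : ℤ) : ℝ) - n i = m * H i := by simp
    rw [this, abs_mul, Nat.abs_cast]
    exact hHD i
  have hy : ∀ i, |(n i : ℝ)| ≤ X := mem_latticeBox.1 hn
  have hmono := abs_prod_pow_sub_prod_pow_mul_le Finset.univ
    (fun i => (((n + m • H) i : ℤ) : ℝ)) (fun i => (n i : ℝ)) γ (Y := 2 * X) (D := q * D)
    (fun i => by
      have h1 := abs_sub_abs_le_abs_sub (((n + m • H) i : ℤ) : ℝ) (n i)
      linarith [hxy i, hy i])
    (fun i => by linarith [hy i]) hxy (by positivity) (by positivity)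
  rw [← hP, ← hQ, hPQ, abs_mul, Nat.abs_cast] at hmono
  have hcX : |(c : ℝ)| * X ≤ ((∑ i, γ i : ℕ) : ℝ) * (2 * X) ^ (∑ i, γ i) * D := by
    have h1 : q * (|(c : ℝ)| * (2 * X)) ≤
        q * (((∑ i, γ i : ℕ) : ℝ) * (2 * X) ^ (∑ i, γ i) * D) := by
      calc q * (|(c : ℝ)| * (2 * X)) = q * |(c : ℝ)| * (2 * X) := by ring
        _ ≤ _ := hmono
        _ = _ := by ring
    have h2 := le_of_mul_le_mul_left h1 hq0
    have : 0 ≤ |(c : ℝ)| * X := by positivity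
    linarith
  refine ⟨round (q * ξ) * c, ?_⟩
  have h1 : ξ * P - ξ * Q - ((round (q * ξ) * c : ℤ) : ℝ) = (q * ξ - round (q * ξ)) * c := by
    rw [← mul_sub, hPQ]; push_cast; ring
  rw [h1, abs_mul]
  change distInt (q * ξ) * |(c : ℝ)| * X ≤ _
  calc distInt (q * ξ) * |(c : ℝ)| * X = distInt (q * ξ) * (|(c : ℝ)| * X) := by ring
    _ ≤ distInt (q * ξ) * (((∑ i, γ i : ℕ) : ℝ) * (2 * X) ^ (∑ i, γ i) * D) := by
        gcongr
        exact distInt_nonneg _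
    _ = distInt (q * ξ) * X ^ (∑ i, γ i) * (((∑ i, γ i : ℕ) : ℝ) * 2 ^ (∑ i, γ i) * D) := by
        rw [mul_pow]; ring
    _ ≤ _ := by gcongr

/-- Removing a slowly varying phase from an exponential sum. -/
theorem norm_sum_ee_le_of_phase {M : ℕ} {p g : ℕ → ℝ} {c δ : ℝ}
    (h : ∀ m < M, ∃ z : ℤ, |g m - c - z| ≤ δ) :
    ‖∑ m ∈ Finset.range M, ee (p m + g m)‖ ≤
      ‖∑ m ∈ Finset.range M, ee (p m)‖ + M * (2 * Real.pi * δ) := by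
  have h1 : ∀ m ∈ Finset.range M, ‖ee (p m + g m) - ee c * ee (p m)‖ ≤ 2 * Real.pi * δ := by
    intro m hm
    obtain ⟨z, hz⟩ := h m (Finset.mem_range.1 hm)
    have h2 : ee (g m) = ee c * ee (g m - c - z) := by
      have : g m = c + ((g m - c - z) + z) := by ring
      conv_lhs => rw [this, ee_add, ee_add, ee_int, mul_one]
    have h3 : ee (p m + g m) - ee c * ee (p m) = ee c * ee (p m) * (ee (g m - c - z) - 1) := by
      rw [ee_add, h2]; ring
    rw [h3, norm_mul, norm_mul, norm_ee, norm_ee, one_mul, one_mul]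
    refine (norm_ee_sub_one_le _).trans ?_
    have := Real.pi_pos
    gcongr
  have h4 : ∑ m ∈ Finset.range M, ee (p m + g m) = ee c * ∑ m ∈ Finset.range M, ee (p m) +
      ∑ m ∈ Finset.range M, (ee (p m + g m) - ee c * ee (p m)) := by
    rw [Finset.mul_sum, ← Finset.sum_add_distrib]
    exact Finset.sum_congr rfl fun m _ => by ring
  rw [h4]
  refine (norm_add_le _ _).trans ?_
  rw [norm_mul, norm_ee, one_mul]
  gcongr
  refine (norm_sum_le_of_le _ h1).trans ?_
  simp

end

section

open Polynomial

/-- One step of the descent on degrees. Suppose that the coefficients of degree above `j` are close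
to rationals with denominator `q`. Along a progression of difference `q h` whose length is a small
multiple of `X`, the part of degree above `j` is almost constant modulo `1`. What remains has degree
at most `j` on the progression, and its leading coefficient `q^j P_j(h)` does not depend on the base
point, so that the one-variable result applies to it. -/
theorem IsLargeSum.exists_distInt_formPart_le (k d j : ℕ) (hj : 1 ≤ j) (B : ℕ) :
    ∃ B₁ B₂ : ℕ, ∀ (K X : ℝ) (ξ : (Fin k → ℕ) → ℝ) (w : (Fin k → ℤ) → ℂ), 2 ≤ K → K ^ B₁ < X →
      IsLargeSum d K X ξ w → ∀ q : ℕ, 1 ≤ q → (q : ℝ) ≤ K ^ B →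
      (∀ γ ∈ indexGrid k d, j < ∑ i, γ i → distInt (q * ξ γ) * X ^ (∑ i, γ i) ≤ K ^ B) →
      ∀ h ∈ indexGrid k d, ∃ r : ℕ, 1 ≤ r ∧ (r : ℝ) ≤ K ^ B₂ ∧
        distInt (r * ((q : ℝ) ^ j * formPart d j ξ h)) * X ^ j ≤ K ^ B₂ := by
  obtain ⟨A, hA⟩ := exists_distInt_leadingCoeff_le j hj
  set c₀ : ℕ := (d + 1) ^ k * ((k * d) * 2 ^ (k * d) * d) with hc₀
  set c₁ : ℕ := 16 * 3 ^ (k + 1) * c₀ with hc₁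
  set B₁ := B + 2 + c₁ + 2 * (k * d) + d with hB₁
  set b := 2 * 3 ^ (k + 1) + 1 with hb
  refine ⟨B₁, b * A + (B₁ + 1) * j, fun K X ξ w hK hKX hL q hq1 hqK hξ h hh => ?_⟩
  have hK1 : 1 ≤ K := by linarith
  have hK0 : 0 < K := by linarith
  have hmono : ∀ {m n : ℕ}, m ≤ n → K ^ m ≤ K ^ n := fun h => pow_le_pow_right₀ hK1 h
  have hX1 : 1 ≤ X := (one_le_pow₀ hK1).trans hKX.le
  have hX0 : 0 < X := by linarith
  -- The length of the progressions, short enough for the phase of degree above `j` to be constant.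
  set M := ⌊X / K ^ B₁⌋₊ with hM
  have hMle : (M : ℝ) * K ^ B₁ ≤ X := by
    rw [← le_div_iff₀ (by positivity)]
    exact Nat.floor_le (by positivity)
  have hone : 1 ≤ X / K ^ B₁ := by rw [le_div_iff₀ (by positivity)]; linarith
  have hM1 : 1 ≤ M := Nat.le_floor (by exact_mod_cast hone)
  have hM1' : (1 : ℝ) ≤ M := by exact_mod_cast hM1
  have hXM : X ≤ K ^ (B₁ + 1) * M := by
    have h1 : X / K ^ B₁ < M + 1 := Nat.lt_floor_add_one _
    rw [div_lt_iff₀ (by positivity)] at h1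
    calc X ≤ (M + 1) * K ^ B₁ := h1.le
      _ ≤ (2 * M) * K ^ B₁ := by gcongr; linarith
      _ ≤ (K * M) * K ^ B₁ := by gcongr
      _ = K ^ (B₁ + 1) * M := by ring
  have hq0 : (0 : ℝ) ≤ q := Nat.cast_nonneg _
  obtain ⟨n, hn, hline⟩ := hL.exists_line hK0 hX1 q hh hM1 (by
    calc 2 * K ^ 2 * q * (k * d) * M ≤ 2 * K ^ 2 * K ^ B * (k * d) * M := by gcongr
      _ = ((2 * (k * d) : ℕ) : ℝ) * K ^ 2 * K ^ B * M := by push_cast; ring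
      _ ≤ K ^ (2 * (k * d)) * K ^ 2 * K ^ B * M := by gcongr; exact natCast_le_pow hK _
      _ = M * K ^ (2 * (k * d) + 2 + B) := by ring
      _ ≤ M * K ^ B₁ := by gcongr ?_ * ?_; exact hmono (by omega)
      _ ≤ X := hMle)
  set H : Fin k → ℤ := fun i => (q : ℤ) * h i with hH
  set Γ := (indexGrid k d).filter fun γ => ∑ i, γ i ≤ j with hΓ
  set Γ' := (indexGrid k d).filter fun γ => ¬ ∑ i, γ i ≤ j with hΓ'
  set p := linePoly Γ ξ n H with hp
  set g : ℕ → ℝ := fun m => ∑ γ ∈ Γ', ξ γ * ∏ i, (((n + m • H) i : ℤ) : ℝ) ^ γ i with hg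
  have hsplit : ∀ m : ℕ, gridPoly d ξ (n + m • H) = p.eval (m : ℝ) + g m := by
    intro m
    rw [hp, eval_linePoly, hg, gridPoly]
    exact (Finset.sum_filter_add_sum_filter_not _ _ _).symm
  set δ : ℝ := K ^ B * c₀ * M / X with hδ
  have hphase : ∀ m < M, ∃ z : ℤ, |g m - ∑ γ ∈ Γ', ξ γ * ∏ i, (n i : ℝ) ^ γ i - z| ≤ δ := by
    intro m hm
    have hm' : (m : ℝ) ≤ M := by exact_mod_cast hm.le
    have hγ : ∀ γ ∈ Γ', ∃ z : ℤ, |ξ γ * ∏ i, (((n + m • H) i : ℤ) : ℝ) ^ γ i -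
        ξ γ * ∏ i, (n i : ℝ) ^ γ i - z| * X ≤ K ^ B * ((k * d : ℕ) * 2 ^ (k * d) * (d * M)) := by
      intro γ hγ
      obtain ⟨hγ1, hγ2⟩ := Finset.mem_filter.1 hγ
      obtain ⟨z, hz⟩ := exists_int_abs_monomial_sub_le (D := d * M) hq1
        (hξ γ hγ1 (not_le.1 hγ2)) hX1 n H m (fun i => dvd_mul_right _ _) hn
        (fun i => by
          have h1 : |(H i : ℝ)| = q * h i := by
            rw [hH]; push_cast; rw [abs_of_nonneg (by positivity)]
          have h2 : (h i : ℝ) ≤ d := by exact_mod_cast mem_indexGrid.1 hh i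
          rw [h1]
          calc (m : ℝ) * (q * h i) ≤ M * (q * d) := by gcongr
            _ = q * (d * M) := by ring)
        (by
          calc (q : ℝ) * (d * M) ≤ K ^ B * (K ^ d * M) := by
                gcongr
                exact natCast_le_pow hK d
            _ = M * K ^ (B + d) := by ring
            _ ≤ M * K ^ B₁ := by gcongr ?_ * ?_; exact hmono (by omega)
            _ ≤ X := hMle)
        (by positivity)
      refine ⟨z, hz.trans ?_⟩
      have hle := sum_le_of_mem_indexGrid hγ1
      gcongr
      norm_num
    choose! z hz using hγ
    refine ⟨∑ γ ∈ Γ', z γ, ?_⟩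
    rw [hδ, le_div_iff₀ hX0, hg]
    push_cast
    rw [← Finset.sum_sub_distrib, ← Finset.sum_sub_distrib]
    calc |∑ γ ∈ Γ', (ξ γ * ∏ i, (((n + m • H) i : ℤ) : ℝ) ^ γ i -
          ξ γ * ∏ i, (n i : ℝ) ^ γ i - z γ)| * X
        ≤ (∑ γ ∈ Γ', |ξ γ * ∏ i, (((n + m • H) i : ℤ) : ℝ) ^ γ i -
          ξ γ * ∏ i, (n i : ℝ) ^ γ i - z γ|) * X := by
          gcongr
          exact Finset.abs_sum_le_sum_abs _ _
      _ ≤ ∑ γ ∈ Γ', K ^ B * ((k * d : ℕ) * 2 ^ (k * d) * (d * M)) := by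
          rw [Finset.sum_mul]
          exact Finset.sum_le_sum hz
      _ = Γ'.card * (K ^ B * ((k * d : ℕ) * 2 ^ (k * d) * (d * M))) := by simp
      _ ≤ ((d + 1) ^ k : ℕ) * (K ^ B * ((k * d : ℕ) * 2 ^ (k * d) * (d * M))) := by
          gcongr
          rw [← card_indexGrid]
          exact Finset.card_filter_le _ _
      _ = K ^ B * c₀ * M := by rw [hc₀]; push_cast; ring
  have hδ0 : 0 ≤ δ := by positivity
  have hδle : 3 ^ (k + 1) * K * (2 * Real.pi * δ) ≤ 1 / 2 := by
    have h1 : c₁ * K ^ (B + 1) * M ≤ X := by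
      calc (c₁ : ℝ) * K ^ (B + 1) * M ≤ K ^ c₁ * K ^ (B + 1) * M := by
            gcongr; exact natCast_le_pow hK _
        _ = M * K ^ (c₁ + (B + 1)) := by ring
        _ ≤ M * K ^ B₁ := by gcongr ?_ * ?_; exact hmono (by omega)
        _ ≤ X := hMle
    have h2 : 3 ^ (k + 1) * K * (8 * δ) = c₁ * K ^ (B + 1) * M / X / 2 := by
      rw [hδ, hc₁]; push_cast; ring
    have h3 : c₁ * K ^ (B + 1) * M / X ≤ 1 := by rw [div_le_one hX0]; exact h1
    have h4 : 2 * Real.pi * δ ≤ 8 * δ := by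
      gcongr
      linarith [Real.pi_le_four]
    calc 3 ^ (k + 1) * K * (2 * Real.pi * δ) ≤ 3 ^ (k + 1) * K * (8 * δ) := by gcongr
      _ ≤ 1 / 2 := by rw [h2]; linarith
  have hSp : (M : ℝ) ≤ K ^ b * ‖∑ m ∈ Finset.range M, ee (p.eval (m : ℝ))‖ := by
    simp only [hsplit] at hline
    have h1 := norm_sum_ee_le_of_phase (p := fun m => p.eval (m : ℝ)) hphase
    set S := ‖∑ m ∈ Finset.range M, ee (p.eval (m : ℝ))‖ with hS
    have h2 : (M : ℝ) ≤ 3 ^ (k + 1) * K * S + M * (1 / 2) := by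
      calc (M : ℝ) ≤ 3 ^ (k + 1) * K * (S + M * (2 * Real.pi * δ)) := by
            refine hline.trans ?_
            gcongr
        _ = 3 ^ (k + 1) * K * S + M * (3 ^ (k + 1) * K * (2 * Real.pi * δ)) := by ring
        _ ≤ _ := by gcongr
    calc (M : ℝ) ≤ ((2 * 3 ^ (k + 1) : ℕ) : ℝ) * K * S := by push_cast; linarith
      _ ≤ K ^ (2 * 3 ^ (k + 1)) * K * S := by gcongr; exact natCast_le_pow hK _
      _ = K ^ b * S := by rw [hb, pow_succ K]
  obtain ⟨r, hr1, hrK, hr⟩ := hA (K ^ b) (hK.trans (le_self_pow₀ hK1 (by omega))) M p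
    (natDegree_linePoly_le (fun γ hγ => (Finset.mem_filter.1 hγ).2) ξ n H) hSp
  rw [hp, hH, hΓ, coeff_linePoly] at hr
  rw [← pow_mul] at hrK hr
  refine ⟨r, hr1, hrK.trans (hmono (by omega)), ?_⟩
  calc distInt (r * ((q : ℝ) ^ j * formPart d j ξ h)) * X ^ j
      ≤ distInt (r * ((q : ℝ) ^ j * formPart d j ξ h)) * (K ^ (B₁ + 1) * M) ^ j := by
        gcongr
        exact distInt_nonneg _
    _ = distInt (r * ((q : ℝ) ^ j * formPart d j ξ h)) * (M : ℝ) ^ j * K ^ ((B₁ + 1) * j) := by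
        rw [mul_pow, ← pow_mul]; ring
    _ ≤ K ^ (b * A) * K ^ ((B₁ + 1) * j) := by gcongr
    _ = _ := by rw [← pow_add]

/-- Passing from the values of a form on the grid to its coefficients. -/
theorem distInt_factorial_mul_le_of_formPart {k d : ℕ} {ξ : (Fin k → ℕ) → ℝ} {γ : Fin k → ℕ}
    (hγ : γ ∈ indexGrid k d) {s ε : ℝ}
    (h : ∀ h ∈ indexGrid k d, distInt (s * formPart d (∑ i, γ i) ξ h) ≤ ε) :
    distInt ((∏ i, (γ i).factorial : ℕ) * (s * ξ γ)) ≤ 2 ^ (∑ i, γ i) * ε := by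
  have h1 : ((∏ i, (γ i).factorial : ℕ) : ℝ) * (s * ξ γ) =
      ∑ h ∈ Fintype.piFinset (fun i => Finset.range (γ i + 1)),
        ((∏ i, ((-1 : ℤ) ^ (γ i - h i) * (γ i).choose (h i)) : ℤ) : ℝ) *
          (s * formPart d (∑ i, γ i) ξ h) := by
    have := sum_choose_mul_formPart ξ hγ
    push_cast
    calc (∏ i, ((γ i).factorial : ℝ)) * (s * ξ γ) = s * ((∏ i, ((γ i).factorial : ℝ)) * ξ γ) := by
          ring
      _ = _ := by
          rw [← this, Finset.mul_sum]
          exact Finset.sum_congr rfl fun h _ => by ring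
  rw [h1]
  calc _ ≤ ∑ h ∈ Fintype.piFinset (fun i => Finset.range (γ i + 1)),
        (∏ i, ((γ i).choose (h i) : ℝ)) * ε := by
        refine (distInt_sum_le _ _).trans (Finset.sum_le_sum fun t ht => ?_)
        refine (distInt_int_mul_le _ _).trans ?_
        have h2 : |((∏ i, ((-1 : ℤ) ^ (γ i - t i) * (γ i).choose (t i)) : ℤ) : ℝ)| =
            ∏ i, ((γ i).choose (t i) : ℝ) := by
          push_cast
          rw [Finset.abs_prod]
          refine Finset.prod_congr rfl fun i _ => ?_
          rw [abs_mul, abs_pow, abs_neg, abs_one, one_pow, one_mul, Nat.abs_cast]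
        rw [h2]
        gcongr
        refine h t (mem_indexGrid.2 fun i => ?_)
        have h3 := Finset.mem_range.1 (Fintype.mem_piFinset.1 ht i)
        have h4 := mem_indexGrid.1 hγ i
        omega
    _ = 2 ^ (∑ i, γ i) * ε := by
        rw [← Finset.sum_mul]
        congr 1
        rw [← Finset.prod_univ_sum (fun i => Finset.range (γ i + 1))
          (fun i j => ((γ i).choose j : ℝ)), ← Finset.prod_pow_eq_pow_sum]
        refine Finset.prod_congr rfl fun i _ => ?_
        exact_mod_cast Nat.sum_range_choose (γ i)

/-- The inverse theorem: if a weighted exponential sum over a box of size `X` is large up to a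
factor `K`, then all coefficients of positive degree (here: of degree at least `j ≥ 1`) are within
`K ^ O(1) / X ^ |γ|` of rational numbers with a common denominator of size at most `K ^ O(1)`. -/
theorem IsLargeSum.exists_common_denominator (k d t j : ℕ) (hj : 1 ≤ j) (hjt : j + t = k * d + 1) :
    ∃ B : ℕ, ∀ (K X : ℝ) (ξ : (Fin k → ℕ) → ℝ) (w : (Fin k → ℤ) → ℂ), 2 ≤ K → 1 ≤ X →
      IsLargeSum d K X ξ w → ∃ q : ℕ, 1 ≤ q ∧ (q : ℝ) ≤ K ^ B ∧
        ∀ γ ∈ indexGrid k d, j ≤ ∑ i, γ i → distInt (q * ξ γ) * X ^ (∑ i, γ i) ≤ K ^ B := by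
  induction t generalizing j with
  | zero =>
    refine ⟨0, fun K X ξ w _ _ _ => ⟨1, le_rfl, by simp, fun γ hγ hγj => ?_⟩⟩
    have := sum_le_of_mem_indexGrid hγ
    omega
  | succ t ih =>
    obtain ⟨B, hB⟩ := ih (j + 1) (by omega) (by omega)
    obtain ⟨B₁, B₂, hstep⟩ := IsLargeSum.exists_distInt_formPart_le k d j hj B
    set F : ℕ := d.factorial ^ k with hF
    set G : ℕ := (d + 1) ^ k with hG
    set E := B₂ * G + B * (j + 1) + F + j + B₂ + B + B₁ * (k * d) with hE
    refine ⟨E, fun K X ξ w hK hX hL => ?_⟩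
    have hK1 : 1 ≤ K := by linarith
    have hK0 : 0 < K := by linarith
    have hX0 : 0 < X := by linarith
    have hmono : ∀ {m n : ℕ}, m ≤ n → K ^ m ≤ K ^ n := fun h => pow_le_pow_right₀ hK1 h
    -- For `X ≤ K ^ B₁` there is nothing to prove: `q = 1` works.
    rcases le_or_gt X (K ^ B₁) with hXK | hXK
    · refine ⟨1, le_rfl, by simpa using one_le_pow₀ hK1, fun γ hγ _ => ?_⟩
      calc distInt _ * X ^ (∑ i, γ i) ≤ 1 * (K ^ B₁) ^ (k * d) := by
            gcongr
            · exact (distInt_le_half _).trans (by norm_num)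
            · exact (pow_le_pow_left₀ hX0.le hXK _).trans
                (pow_le_pow_right₀ (one_le_pow₀ hK1) (sum_le_of_mem_indexGrid hγ))
        _ = K ^ (B₁ * (k * d)) := by rw [one_mul, ← pow_mul]
        _ ≤ K ^ E := hmono (by omega)
    obtain ⟨q, hq1, hqK, hq⟩ := hB K X ξ w hK hX hL
    have hforms := hstep K X ξ w hK hXK hL q hq1 hqK fun γ hγ hγj => hq γ hγ hγj
    obtain ⟨R, hR1, hRK, hR⟩ := exists_common_multiplier (indexGrid k d)
      (fun h => (q : ℝ) ^ j * formPart d j ξ h) (Q := K ^ B₂) (ε := K ^ B₂ / X ^ j)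
      (one_le_pow₀ hK1) fun h hh => by
        obtain ⟨r, hr1, hrK, hr⟩ := hforms h hh
        exact ⟨r, hr1, hrK, by rwa [le_div_iff₀ (by positivity)]⟩
    rw [card_indexGrid, ← hG, ← pow_mul] at hRK hR
    have hFK : (F : ℝ) ≤ K ^ F := natCast_le_pow hK F
    have hqpow : ∀ e : ℕ, (q : ℝ) ^ e ≤ K ^ (B * e) := fun e => by
      rw [pow_mul]; exact pow_le_pow_left₀ (Nat.cast_nonneg _) hqK e
    -- `R * q ^ j` handles the values of the form of degree `j`, the factor `F` clears the
    -- factorials from the interpolation, and the last `q` handles the higher coefficients.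
    refine ⟨R * q ^ (j + 1) * F, ?_, ?_, fun γ hγ hγj => ?_⟩
    · exact Nat.succ_le_of_lt (by positivity)
    · push_cast
      calc (R : ℝ) * (q : ℝ) ^ (j + 1) * F ≤ K ^ (B₂ * G) * K ^ (B * (j + 1)) * K ^ F := by
            gcongr
            exact hqpow _
        _ = K ^ (B₂ * G + B * (j + 1) + F) := by rw [pow_add, pow_add]
        _ ≤ K ^ E := hmono (by omega)
    rcases eq_or_lt_of_le hγj with hγj | hγj
    · have hR' : ∀ h ∈ indexGrid k d,
          distInt ((R * (q : ℝ) ^ j) * formPart d (∑ i, γ i) ξ h) ≤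
            K ^ (B₂ * G) * (K ^ B₂ / X ^ j) := by
        intro h hh
        rw [← hγj, mul_assoc]
        exact hR h hh
      have h1 := distInt_factorial_mul_le_of_formPart hγ hR'
      obtain ⟨f, hf⟩ : (∏ i, (γ i).factorial) ∣ F := by
        have h2 : F = ∏ _i : Fin k, d.factorial := by simp [hF]
        rw [h2]
        exact Finset.prod_dvd_prod_of_dvd _ _ fun i _ =>
          Nat.factorial_dvd_factorial (mem_indexGrid.1 hγ i)
      have hfF : (f : ℝ) ≤ F := by
        have : f ≤ F := by
          rw [hf]; exact Nat.le_mul_of_pos_left _ (Finset.prod_pos fun i _ => Nat.factorial_pos _)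
        exact_mod_cast this
      have h3 : ((R * q ^ (j + 1) * F : ℕ) : ℝ) * ξ γ = ((q * f : ℕ) : ℝ) *
          ((∏ i, (γ i).factorial : ℕ) * ((R * (q : ℝ) ^ j) * ξ γ)) := by
        rw [hf]; push_cast; ring
      rw [h3, ← hγj]
      rw [← hγj] at h1
      calc _ ≤ ((q * f : ℕ) : ℝ) * (2 ^ j * (K ^ (B₂ * G) * (K ^ B₂ / X ^ j))) * X ^ j := by
            gcongr
            exact (distInt_nat_mul_le _ _).trans (by gcongr)
        _ = q * f * 2 ^ j * K ^ (B₂ * G) * K ^ B₂ := by push_cast; field_simp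
        _ ≤ K ^ B * K ^ F * K ^ j * K ^ (B₂ * G) * K ^ B₂ := by
            gcongr
            exact hfF.trans hFK
        _ = K ^ (B + F + j + B₂ * G + B₂) := by simp only [pow_add]
        _ ≤ K ^ E := hmono (by
            have : B ≤ B * (j + 1) := Nat.le_mul_of_pos_right _ (by omega)
            omega)
    · have h3 : ((R * q ^ (j + 1) * F : ℕ) : ℝ) * ξ γ =
          ((R * q ^ j * F : ℕ) : ℝ) * (q * ξ γ) := by push_cast; ring
      rw [h3]
      calc _ ≤ ((R * q ^ j * F : ℕ) : ℝ) * distInt (q * ξ γ) * X ^ (∑ i, γ i) := by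
            gcongr
            exact distInt_nat_mul_le _ _
        _ = ((R * q ^ j * F : ℕ) : ℝ) * (distInt (q * ξ γ) * X ^ (∑ i, γ i)) := by ring
        _ ≤ (K ^ (B₂ * G) * K ^ (B * j) * K ^ F) * K ^ B := by
            push_cast
            gcongr
            · exact mul_nonneg (distInt_nonneg _) (by positivity)
            · exact hqpow j
            · exact hq γ hγ hγj
        _ = K ^ (B₂ * G + B * j + F + B) := by simp only [pow_add]
        _ ≤ K ^ E := hmono (by
            have : B * (j + 1) = B * j + B := by ring
            omega)

end

/-! ### Variation of a smooth weight cut off to a convex set -/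

/-- Summing over a box a function of one coordinate. -/
theorem sum_latticeBox_coord_mul_le {k : ℕ} {X : ℝ} (hX : 1 ≤ X) (i : Fin k) {f : ℤ → ℝ}
    (hf : ∀ m, 0 ≤ f m) :
    (∑ n ∈ latticeBox k X, f (n i)) * X ≤ (3 * X) ^ k * ∑ m ∈ Finset.Icc (-⌊X⌋) ⌊X⌋, f m := by
  classical
  have h1 : ∑ n ∈ latticeBox k X, f (n i) =
      ∏ j : Fin k, ∑ m ∈ Finset.Icc (-⌊X⌋) ⌊X⌋, if j = i then f m else 1 := by
    rw [Finset.prod_univ_sum]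
    refine Finset.sum_congr rfl fun n _ => ?_
    rw [Finset.prod_ite_eq' Finset.univ i (fun j => f (n j)), if_pos (Finset.mem_univ i)]
  have h2 : 0 ≤ ∑ m ∈ Finset.Icc (-⌊X⌋) ⌊X⌋, f m := Finset.sum_nonneg fun m _ => hf m
  rw [h1, ← Finset.mul_prod_erase Finset.univ _ (Finset.mem_univ i)]
  have h3 : ∏ j ∈ Finset.univ.erase i, ∑ m ∈ Finset.Icc (-⌊X⌋) ⌊X⌋, (if j = i then f m else 1) ≤
      (3 * X) ^ (k - 1) := by
    calc _ ≤ ∏ j ∈ Finset.univ.erase i, 3 * X := by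
          refine Finset.prod_le_prod (fun j hj => ?_) fun j hj => ?_
          · simp [Finset.ne_of_mem_erase hj]
          · simp only [Finset.ne_of_mem_erase hj, if_false, Finset.sum_const, nsmul_eq_mul, mul_one]
            exact card_Icc_floor_le hX
      _ = (3 * X) ^ (k - 1) := by simp
  have hk : (3 * X) ^ k = (3 * X) ^ (k - 1) * (3 * X) := by
    rw [← pow_succ, Nat.sub_add_cancel (Nat.succ_le_of_lt (Nat.zero_lt_of_lt i.2))]
  simp only [if_true]
  calc _ ≤ (∑ m ∈ Finset.Icc (-⌊X⌋) ⌊X⌋, f m) * (3 * X) ^ (k - 1) * (3 * X) := by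
        gcongr
        linarith
    _ = _ := by rw [hk]; ring

/-- A set of lattice points with at most one point on each line parallel to the `i`-th axis. -/
theorem card_mul_le_of_line_subsingleton {k : ℕ} {X : ℝ} (hX : 1 ≤ X) (i : Fin k)
    {E : Finset (Fin k → ℤ)} (hE : E ⊆ latticeBox k X)
    (hline : ∀ n ∈ E, ∀ n' ∈ E, (∀ j ≠ i, n j = n' j) → ¬ n i < n' i) :
    (E.card : ℝ) * X ≤ (3 * X) ^ k := by
  classical
  have h1 : E.card ≤ ((latticeBox k X).filter fun n => n i = 0).card := by
    refine Finset.card_le_card_of_injOn (fun n => Function.update n i 0) (fun n hn => ?_) ?_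
    · simp only [Finset.coe_filter, Set.mem_ofPred_eq, Function.update_self, and_true]
      rw [mem_latticeBox]
      intro j
      rcases eq_or_ne j i with rfl | hj
      · simp; linarith
      · rw [Function.update_of_ne hj]
        exact mem_latticeBox.1 (hE hn) j
    · intro n hn n' hn' hnn
      have hj : ∀ j ≠ i, n j = n' j := fun j hj => by
        have := congrFun hnn j
        simpa [Function.update_of_ne hj] using this
      funext j
      rcases eq_or_ne j i with rfl | hji
      · have h2 := hline n hn n' hn' hj
        have h3 := hline n' hn' n hn fun j hji => (hj j hji).symm
        omega
      · exact hj j hji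
  have h2 := sum_latticeBox_coord_mul_le hX i (f := fun m => if m = 0 then 1 else 0)
    (fun m => by split_ifs <;> norm_num)
  have h3 : ∑ n ∈ latticeBox k X, (if n i = 0 then (1 : ℝ) else 0) =
      ((latticeBox k X).filter fun n => n i = 0).card := by
    rw [Finset.sum_boole]
  have h0 : (0 : ℤ) ∈ Finset.Icc (-⌊X⌋) ⌊X⌋ := mem_Icc_floor.2 (by simp; linarith)
  rw [h3, Finset.sum_ite_eq' _ (0 : ℤ), if_pos h0, mul_one] at h2
  refine le_trans ?_ h2
  gcongr

theorem sum_Icc_inv_one_add_abs_le {X : ℝ} (hX : 1 ≤ X) :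
    ∑ m ∈ Finset.Icc (-⌊X⌋) ⌊X⌋, (1 + |(m : ℝ)|)⁻¹ ≤ 2 * (1 + Real.log (2 * X)) := by
  classical
  have hmaps : ∀ m ∈ Finset.Icc (-⌊X⌋) ⌊X⌋, m.natAbs ∈ Finset.range (⌊X⌋₊ + 1) := by
    intro m hm
    have h1 := mem_Icc_floor.1 hm
    rw [Finset.mem_range, Nat.lt_succ_iff, Nat.le_floor_iff (by linarith), Nat.cast_natAbs]
    exact_mod_cast h1
  rw [← Finset.sum_fiberwise_of_maps_to hmaps]
  have hfib : ∀ j ∈ Finset.range (⌊X⌋₊ + 1),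
      ∑ m ∈ (Finset.Icc (-⌊X⌋) ⌊X⌋).filter (fun m => m.natAbs = j), (1 + |(m : ℝ)|)⁻¹ ≤
        2 * (1 + (j : ℝ))⁻¹ := by
    intro j _
    have h1 : ∀ m ∈ (Finset.Icc (-⌊X⌋) ⌊X⌋).filter (fun m => m.natAbs = j),
        (1 + |(m : ℝ)|)⁻¹ ≤ (1 + (j : ℝ))⁻¹ := by
      intro m hm
      rw [← (Finset.mem_filter.1 hm).2, Nat.cast_natAbs, Int.cast_abs]
    have h2 : ((Finset.Icc (-⌊X⌋) ⌊X⌋).filter (fun m => m.natAbs = j)).card ≤ 2 := by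
      refine (Finset.card_le_card (t := {(j : ℤ), -(j : ℤ)}) fun m hm => ?_).trans
        Finset.card_le_two
      have := (Finset.mem_filter.1 hm).2
      simp only [Finset.mem_insert, Finset.mem_singleton]
      omega
    calc _ ≤ _ := Finset.sum_le_card_nsmul _ _ _ h1
      _ = (((Finset.Icc (-⌊X⌋) ⌊X⌋).filter (fun m => m.natAbs = j)).card : ℝ) *
          (1 + (j : ℝ))⁻¹ := by rw [nsmul_eq_mul]
      _ ≤ 2 * (1 + (j : ℝ))⁻¹ := by
          gcongr
          exact_mod_cast h2
  refine (Finset.sum_le_sum hfib).trans ?_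
  rw [← Finset.mul_sum]
  have hharm : ∑ j ∈ Finset.range (⌊X⌋₊ + 1), (1 + (j : ℝ))⁻¹ = (harmonic (⌊X⌋₊ + 1) : ℝ) := by
    rw [harmonic]
    push_cast
    exact Finset.sum_congr rfl fun j _ => by rw [add_comm]
  rw [hharm]
  have h1 := harmonic_le_one_add_log (⌊X⌋₊ + 1)
  have h2 : Real.log ((⌊X⌋₊ + 1 : ℕ) : ℝ) ≤ Real.log (2 * X) := by
    refine Real.log_le_log (by positivity) ?_
    push_cast
    linarith [Nat.floor_le (show 0 ≤ X by linarith)]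
  linarith

theorem latticePoint_apply {k : ℕ} (n : Fin k → ℤ) (j : Fin k) : latticePoint n j = n j := rfl

/-- A convex set meets the lattice points of a line parallel to a coordinate axis in an interval. -/
theorem latticePoint_mem_of_between {k : ℕ} {Ω : Set (EuclideanSpace ℝ (Fin k))} (hΩ : Convex ℝ Ω)
    {i : Fin k} {n m p : Fin k → ℤ} (hn : latticePoint n ∈ Ω) (hp : latticePoint p ∈ Ω)
    (hnm : ∀ j ≠ i, m j = n j) (hnp : ∀ j ≠ i, p j = n j) (h1 : n i ≤ m i) (h2 : m i ≤ p i) :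
    latticePoint m ∈ Ω := by
  rcases eq_or_lt_of_le (h1.trans h2) with h | h
  · have : m = n := by
      funext j
      rcases eq_or_ne j i with rfl | hj
      · omega
      · exact hnm j hj
    rwa [this]
  · have h1' : (n i : ℝ) ≤ m i := by exact_mod_cast h1
    have h2' : (m i : ℝ) ≤ p i := by exact_mod_cast h2
    have h' : (0 : ℝ) < p i - n i := by
      have : (n i : ℝ) < p i := by exact_mod_cast h
      linarith
    have hmem := hΩ hn hp (a := (p i - m i) / (p i - n i)) (b := (m i - n i) / (p i - n i))
      (div_nonneg (by linarith) h'.le) (div_nonneg (by linarith) h'.le) (by field_simp; ring)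
    convert hmem using 1
    ext j
    simp only [PiLp.add_apply, PiLp.smul_apply, latticePoint_apply, smul_eq_mul]
    rcases eq_or_ne j i with rfl | hj
    · field_simp; ring
    · rw [hnm j hj, hnp j hj]; field_simp; ring

theorem norm_sub_le_of_norm_fderiv_le {k : ℕ} {A : ℝ} {φ : EuclideanSpace ℝ (Fin k) → ℂ}
    (hφ : ContDiff ℝ 1 φ) (hA : 0 ≤ A) (hφ' : ∀ x, ‖fderiv ℝ φ x‖ ≤ A * (1 + ‖x‖)⁻¹)
    (n : Fin k → ℤ) (i : Fin k) :
    ‖φ (latticePoint (n + Pi.single i 1)) - φ (latticePoint n)‖ ≤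
      2 * A * (1 + |(n i : ℝ)|)⁻¹ := by
  have hdiff : latticePoint (n + Pi.single i 1) - latticePoint n = EuclideanSpace.single i 1 := by
    ext j
    simp only [PiLp.sub_apply, latticePoint_apply, Pi.add_apply, PiLp.single_apply,
      Pi.single_apply]
    split_ifs <;> simp
  have hbound : ∀ x ∈ segment ℝ (latticePoint n) (latticePoint (n + Pi.single i 1)),
      ‖fderiv ℝ φ x‖ ≤ 2 * A * (1 + |(n i : ℝ)|)⁻¹ := by
    intro x hx
    rw [segment_eq_image'] at hx
    obtain ⟨t, ht, rfl⟩ := hx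
    rw [hdiff]
    refine (hφ' _).trans ?_
    set x := latticePoint n + t • EuclideanSpace.single i (1 : ℝ) with hx
    have hxi : x i = n i + t := by simp [hx, latticePoint_apply]
    have h1 : |x i| ≤ ‖x‖ := by
      have := PiLp.norm_apply_le x i
      rwa [Real.norm_eq_abs] at this
    have h2 : |(n i : ℝ)| ≤ 1 + ‖x‖ := by
      have h3 : (n i : ℝ) = x i - t := by rw [hxi]; ring
      have h4 : |(n i : ℝ)| ≤ |x i| + |t| := by rw [h3]; exact abs_sub _ _
      have h5 : |t| ≤ 1 := by rw [abs_of_nonneg ht.1]; exact ht.2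
      linarith
    have h6 : (1 + ‖x‖)⁻¹ ≤ 2 * (1 + |(n i : ℝ)|)⁻¹ := by
      rw [← div_eq_mul_inv, inv_eq_one_div, div_le_div_iff₀ (by positivity) (by positivity)]
      linarith [norm_nonneg x]
    calc A * (1 + ‖x‖)⁻¹ ≤ A * (2 * (1 + |(n i : ℝ)|)⁻¹) := by gcongr
      _ = _ := by ring
  have := (convex_segment (𝕜 := ℝ) (latticePoint n)
    (latticePoint (n + Pi.single i 1))).norm_image_sub_le_of_norm_fderiv_le
    (fun x _ => hφ.differentiable (by norm_num) x) hbound (left_mem_segment ℝ _ _)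
    (right_mem_segment ℝ _ _)
  rwa [hdiff, PiLp.norm_single, norm_one, mul_one] at this

open Classical in
/-- The restriction of `φ` to the lattice points of `Ω`, extended by zero. -/
noncomputable def latticeCutoff {k : ℕ} (Ω : Set (EuclideanSpace ℝ (Fin k)))
    (φ : EuclideanSpace ℝ (Fin k) → ℂ) (n : Fin k → ℤ) : ℂ :=
  if latticePoint n ∈ Ω then φ (latticePoint n) else 0

/-- In each coordinate direction the cutoff of a weight with `|∇φ(x)| ≤ A / (1 + |x|)` to a convex
set has variation of order `X^{k-1} log X`: every line enters and leaves the convex set at most once,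
and inside the set the gradient bound leads to a harmonic sum. -/
theorem variation_latticeCutoff_mul_le {k : ℕ} {A X : ℝ} {Ω : Set (EuclideanSpace ℝ (Fin k))}
    {φ : EuclideanSpace ℝ (Fin k) → ℂ} (hΩ : Convex ℝ Ω) (hX : 1 ≤ X)
    (hbox : ∀ n, latticePoint n ∈ Ω → n ∈ latticeBox k X) (hφ : ContDiff ℝ 1 φ) (hA : 0 ≤ A)
    (hφA : ∀ x, ‖φ x‖ ≤ A) (hφ' : ∀ x, ‖fderiv ℝ φ x‖ ≤ A * (1 + ‖x‖)⁻¹) (i : Fin k) :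
    variation (latticeCutoff Ω φ) (Pi.single i 1) * X ≤
      A * (6 * X) ^ k * (6 + 4 * Real.log (4 * X)) := by
  classical
  set e : Fin k → ℤ := Pi.single i 1 with he
  have hei : e i = 1 := by simp [he]
  have hej : ∀ j ≠ i, e j = 0 := fun j hj => by simp [he, hj]
  set F := latticeCutoff Ω φ with hF
  -- The doubled box contains every `n` for which `n` or `n + e` lies in `Ω`.
  have hX2 : 1 ≤ 2 * X := by linarith
  set Bx := latticeBox k (2 * X) with hBx
  have hmemB : ∀ n, latticePoint n ∈ Ω → n ∈ Bx := fun n hn => mem_latticeBox.2 fun j =>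
    (mem_latticeBox.1 (hbox n hn) j).trans (by linarith)
  have hmemB' : ∀ n, latticePoint (n + e) ∈ Ω → n ∈ Bx := fun n hn => mem_latticeBox.2 fun j => by
    have h1 := mem_latticeBox.1 (hbox _ hn) j
    rcases eq_or_ne j i with rfl | hj
    · rw [Pi.add_apply, hei] at h1
      push_cast at h1
      have h2 := abs_sub_abs_le_abs_sub (n j : ℝ) ((n j : ℝ) + 1)
      have h3 : |(n j : ℝ) - ((n j : ℝ) + 1)| = 1 := by
        rw [sub_add_cancel_left, abs_neg, abs_one]
      linarith
    · rw [Pi.add_apply, hej j hj, add_zero] at h1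
      linarith
  set E₁ := Bx.filter fun n => latticePoint n ∈ Ω ∧ latticePoint (n + e) ∉ Ω with hE₁
  set E₂ := Bx.filter fun n => latticePoint n ∉ Ω ∧ latticePoint (n + e) ∈ Ω with hE₂
  have hc₁ : (E₁.card : ℝ) * (2 * X) ≤ (3 * (2 * X)) ^ k := by
    refine card_mul_le_of_line_subsingleton hX2 i (Finset.filter_subset _ _) ?_
    intro n hn n' hn' hj hlt
    obtain ⟨-, hn1, hn2⟩ := Finset.mem_filter.1 hn
    obtain ⟨-, hn1', hn2'⟩ := Finset.mem_filter.1 hn'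
    refine hn2 (latticePoint_mem_of_between hΩ (i := i) hn1 hn1' (fun j hji => ?_)
      (fun j hji => (hj j hji).symm) ?_ ?_)
    · rw [Pi.add_apply, hej j hji, add_zero]
    · rw [Pi.add_apply, hei]; omega
    · rw [Pi.add_apply, hei]; omega
  have hc₂ : (E₂.card : ℝ) * (2 * X) ≤ (3 * (2 * X)) ^ k := by
    refine card_mul_le_of_line_subsingleton hX2 i (Finset.filter_subset _ _) ?_
    intro n hn n' hn' hj hlt
    obtain ⟨-, hn1, hn2⟩ := Finset.mem_filter.1 hn
    obtain ⟨-, hn1', hn2'⟩ := Finset.mem_filter.1 hn'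
    refine hn1' (latticePoint_mem_of_between hΩ (i := i) hn2 hn2' (fun j hji => ?_)
      (fun j hji => ?_) ?_ ?_)
    · rw [Pi.add_apply, hej j hji, add_zero, hj j hji]
    · rw [Pi.add_apply, Pi.add_apply, hj j hji]
    · rw [Pi.add_apply, hei]; omega
    · rw [Pi.add_apply, hei]; omega
  have hsum : variation F e = ∑ n ∈ Bx, ‖F (n + e) - F n‖ := by
    refine tsum_eq_sum fun n hn => ?_
    have h1 : latticePoint n ∉ Ω := fun h => hn (hmemB n h)
    have h2 : latticePoint (n + e) ∉ Ω := fun h => hn (hmemB' n h)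
    simp [hF, latticeCutoff, h1, h2]
  have hpt : ∀ n ∈ Bx, ‖F (n + e) - F n‖ ≤
      A * (if latticePoint n ∈ Ω ∧ latticePoint (n + e) ∉ Ω then 1 else 0) +
      A * (if latticePoint n ∉ Ω ∧ latticePoint (n + e) ∈ Ω then 1 else 0) +
      2 * A * (1 + |(n i : ℝ)|)⁻¹ := by
    intro n _
    have h0 : 0 ≤ 2 * A * (1 + |(n i : ℝ)|)⁻¹ := by positivity
    by_cases h1 : latticePoint n ∈ Ω <;> by_cases h2 : latticePoint (n + e) ∈ Ω
    · simp only [hF, latticeCutoff, h1, h2, if_true, not_true, and_false, false_and, if_false,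
        mul_zero, zero_add]
      exact norm_sub_le_of_norm_fderiv_le hφ hA hφ' n i
    · simp only [hF, latticeCutoff, h1, h2, if_true, not_true, not_false_iff, and_self,
        if_false, mul_zero, zero_sub, norm_neg, mul_one, add_zero]
      linarith [hφA (latticePoint n)]
    · simp only [hF, latticeCutoff, h1, h2, if_true, not_true, not_false_iff, and_self,
        if_false, mul_zero, sub_zero, mul_one, zero_add]
      linarith [hφA (latticePoint (n + e))]
    · simp only [hF, latticeCutoff, h1, h2, if_false, not_false_iff, false_and, and_false,
        mul_zero, sub_zero, norm_zero, zero_add]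
      exact h0
  have hharm := sum_latticeBox_coord_mul_le hX2 i (f := fun m => (1 + |(m : ℝ)|)⁻¹)
    (fun m => by positivity)
  have hlog := sum_Icc_inv_one_add_abs_le hX2
  have h6 : (3 * (2 * X)) = 6 * X := by ring
  rw [h6] at hc₁ hc₂ hharm
  have h4 : 2 * (2 * X) = 4 * X := by ring
  rw [h4] at hlog
  have hmain : variation F e * (2 * X) ≤ A * (6 * X) ^ k * (6 + 4 * Real.log (4 * X)) := by
    calc variation F e * (2 * X)
        ≤ (A * E₁.card + A * E₂.card + 2 * A * ∑ n ∈ Bx, (1 + |(n i : ℝ)|)⁻¹) * (2 * X) := by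
          gcongr
          rw [hsum]
          refine (Finset.sum_le_sum hpt).trans_eq ?_
          rw [Finset.sum_add_distrib, Finset.sum_add_distrib, ← Finset.mul_sum, ← Finset.mul_sum,
            ← Finset.mul_sum, Finset.sum_boole, Finset.sum_boole]
      _ = A * (E₁.card * (2 * X)) + A * (E₂.card * (2 * X)) +
          2 * A * ((∑ n ∈ Bx, (1 + |(n i : ℝ)|)⁻¹) * (2 * X)) := by ring
      _ ≤ A * (6 * X) ^ k + A * (6 * X) ^ k +
          2 * A * ((6 * X) ^ k * (2 * (1 + Real.log (4 * X)))) := by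
          have h7 := hharm.trans (mul_le_mul_of_nonneg_left hlog (by positivity))
          gcongr ?_ + ?_ + ?_
          · exact mul_le_mul_of_nonneg_left hc₁ hA
          · exact mul_le_mul_of_nonneg_left hc₂ hA
          · exact mul_le_mul_of_nonneg_left h7 (by positivity)
      _ = _ := by ring
  have hv := variation_nonneg F e
  nlinarith

/-! ### From the inverse theorem to the Weyl sum -/

/-- A polynomial of total degree at most `d` as a sum over the grid of multi-indices. -/
theorem gridPoly_coeff_eq_eval {k d : ℕ} {P : MvPolynomial (Fin k) ℝ} (hP : P.totalDegree ≤ d)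
    (n : Fin k → ℤ) :
    gridPoly d (fun γ => P.coeff (Finsupp.equivFunOnFinite.symm γ)) n =
      MvPolynomial.eval (fun i => (n i : ℝ)) P := by
  classical
  rw [MvPolynomial.eval_eq', gridPoly]
  symm
  have hsub : P.support.map Finsupp.equivFunOnFinite.toEmbedding ⊆ indexGrid k d := by
    intro γ hγ
    obtain ⟨s, hs, rfl⟩ := Finset.mem_map.1 hγ
    refine mem_indexGrid.2 fun i => ?_
    have h1 := MvPolynomial.le_totalDegree hs
    have h2 : s i ≤ s.degree := Finsupp.le_degree i s
    have h3 : s.degree = s.sum fun _ e => e := rfl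
    simp only [Equiv.coe_toEmbedding, Finsupp.equivFunOnFinite_apply]
    omega
  rw [← Finset.sum_subset hsub, Finset.sum_map]
  · refine Finset.sum_congr rfl fun s _ => ?_
    simp
  · intro γ _ hγ
    have : P.coeff (Finsupp.equivFunOnFinite.symm γ) = 0 := by
      by_contra hne
      exact hγ (Finset.mem_map.2 ⟨Finsupp.equivFunOnFinite.symm γ,
        MvPolynomial.mem_support_iff.2 hne, by simp⟩)
    rw [this, zero_mul]

theorem weylSum_eq_tsum {k d : ℕ} {P : MvPolynomial (Fin k) ℝ} (hP : P.totalDegree ≤ d)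
    {Ω : Set (EuclideanSpace ℝ (Fin k))} (hΩ : Bornology.IsBounded Ω)
    (φ : EuclideanSpace ℝ (Fin k) → ℂ) :
    weylSum P Ω φ =
      ∑' n, ee (gridPoly d (fun γ => P.coeff (Finsupp.equivFunOnFinite.symm γ)) n) *
        latticeCutoff Ω φ n := by
  have hfin : (fun n => ee (gridPoly d (fun γ => P.coeff (Finsupp.equivFunOnFinite.symm γ)) n) *
      latticeCutoff Ω φ n).support.Finite := by
    refine (finite_latticePoint_mem hΩ).subset fun n hn => ?_
    by_contra hcon
    refine right_ne_zero_of_mul hn ?_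
    exact if_neg hcon
  rw [tsum_eq_finsum hfin, weylSum, finsum_mem_def]
  refine finsum_congr fun n => ?_
  rw [gridPoly_coeff_eq_eval hP]
  by_cases hn : latticePoint n ∈ Ω
  · rw [Set.indicator_of_mem (show n ∈ {n | latticePoint n ∈ Ω} from hn), latticeCutoff, if_pos hn]
    rfl
  · rw [Set.indicator_of_notMem (show n ∉ {n | latticePoint n ∈ Ω} from hn), latticeCutoff,
      if_neg hn, mul_zero]

/-- The trivial bound for a Weyl sum. -/
theorem norm_weylSum_le {k d : ℕ} {P : MvPolynomial (Fin k) ℝ} (hP : P.totalDegree ≤ d)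
    {Ω : Set (EuclideanSpace ℝ (Fin k))} (hΩ : Bornology.IsBounded Ω)
    {φ : EuclideanSpace ℝ (Fin k) → ℂ} {A X : ℝ} (hA : 0 ≤ A) (hX : 1 ≤ X)
    (hbox : ∀ n, latticePoint n ∈ Ω → n ∈ latticeBox k X) (hφ : ∀ x, ‖φ x‖ ≤ A) :
    ‖weylSum P Ω φ‖ ≤ A * (3 * X) ^ k := by
  rw [weylSum_eq_tsum hP hΩ, tsum_eq_sum (s := latticeBox k X) fun n hn => by
    rw [latticeCutoff, if_neg fun h => hn (hbox n h), mul_zero]]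
  calc _ ≤ ∑ n ∈ latticeBox k X, A := by
        refine norm_sum_le_of_le _ fun n _ => ?_
        rw [norm_mul, norm_ee, one_mul, latticeCutoff]
        split_ifs
        · exact hφ _
        · simpa using hA
    _ = (latticeBox k X).card * A := by simp
    _ ≤ (3 * X) ^ k * A := by
        gcongr
        exact card_latticeBox_le k hX
    _ = _ := mul_comm _ _

/-- Two rational approximations of `ξ` exclude each other: a reduced fraction `a / q` with error at
most `1 / q ^ 2`, where `2 Q < q < D / (2 Q)`, and a denominator `r ≤ Q` for which `rξ` is within
`Q / D` of an integer. The two fractions are too close to be different, but `q > r`. -/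
theorem false_of_two_approximations {ξ Q D : ℝ} {a q : ℤ} {r : ℕ} (haq : IsCoprime a q) (hq0 : 0 < q)
    (hξ : |ξ - a / q| ≤ 1 / (q : ℝ) ^ 2) (hD : 0 < D) (hr1 : 1 ≤ r) (hrQ : (r : ℝ) ≤ Q)
    (hr : distInt (r * ξ) * D ≤ Q) (hqQ : 2 * Q < q) (hqD : 2 * Q * q < D) : False := by
  have hq : (0 : ℝ) < q := by exact_mod_cast hq0
  have hQ0 : 0 ≤ Q := (Nat.cast_nonneg r).trans hrQ
  set z := round (r * ξ) with hz
  have h1 : |a - q * ξ| ≤ 1 / q := by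
    have h2 : a - q * ξ = -(q * (ξ - a / q)) := by field_simp; ring
    rw [h2, abs_neg, abs_mul, abs_of_pos hq]
    calc q * |ξ - a / q| ≤ q * (1 / (q : ℝ) ^ 2) := by gcongr
      _ = 1 / q := by field_simp
  have h2 : |r * ξ - z| ≤ Q / D := by rw [le_div_iff₀ hD]; exact hr
  have h3 : |((a * r - z * q : ℤ) : ℝ)| < 1 := by
    have h4 : ((a * r - z * q : ℤ) : ℝ) = r * (a - q * ξ) + q * (r * ξ - z) := by push_cast; ring
    rw [h4]
    calc |r * (a - q * ξ) + q * (r * ξ - z)| ≤ |r * (a - q * ξ)| + |q * (r * ξ - z)| :=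
          abs_add_le _ _
      _ = r * |a - q * ξ| + q * |r * ξ - z| := by
          rw [abs_mul, abs_mul, abs_of_pos hq, Nat.abs_cast]
      _ ≤ Q * (1 / q) + q * (Q / D) := by gcongr
      _ < 1 / 2 + 1 / 2 := by
          refine add_lt_add ?_ ?_
          · rw [mul_one_div, div_lt_div_iff₀ hq (by norm_num)]; linarith
          · rw [← mul_div_assoc, div_lt_div_iff₀ hD (by norm_num)]; linarith
      _ = 1 := by norm_num
  have h5 : a * r - z * q = 0 := by
    rw [← Int.abs_lt_one_iff]
    exact_mod_cast h3
  have h6 : q ∣ (r : ℤ) := haq.symm.dvd_of_dvd_mul_left ⟨z, by linarith⟩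
  have h7 : q ≤ r := Int.le_of_dvd (by exact_mod_cast hr1) h6
  have h8 : (q : ℝ) ≤ r := by exact_mod_cast h7
  have h9 : (1 : ℝ) ≤ r := by exact_mod_cast hr1
  linarith

theorem mem_latticeBox_of_mem_closedBall {k : ℕ} {Ω : Set (EuclideanSpace ℝ (Fin k))}
    {x₀ : EuclideanSpace ℝ (Fin k)} {r ρ X : ℝ} (hx₀ : ‖x₀‖ ≤ r)
    (hΩ : Ω ⊆ Metric.closedBall x₀ ρ) (hX : r + ρ ≤ X) {n : Fin k → ℤ}
    (hn : latticePoint n ∈ Ω) : n ∈ latticeBox k X := by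
  refine mem_latticeBox.2 fun i => ?_
  have h1 : ‖latticePoint n - x₀‖ ≤ ρ := by simpa [dist_eq_norm] using hΩ hn
  have h2 : ‖latticePoint n‖ ≤ ‖latticePoint n - x₀‖ + ‖x₀‖ := by
    simpa using norm_add_le (latticePoint n - x₀) x₀
  have h3 := PiLp.norm_apply_le (latticePoint n) i
  rw [latticePoint_apply, Real.norm_eq_abs] at h3
  linarith

/-- The hypotheses of the inverse theorem hold for a Weyl sum that exceeds `N ^ k (log N) ^ (-α)`
by a constant factor, as soon as `log N` is large. -/
theorem isLargeSum_latticeCutoff {k d : ℕ} {α A b N : ℝ} {P : MvPolynomial (Fin k) ℝ}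
    {Ω : Set (EuclideanSpace ℝ (Fin k))} {φ : EuclideanSpace ℝ (Fin k) → ℂ}
    (hα : 0 < α) (hP : P.totalDegree ≤ d) (hΩ : Convex ℝ Ω) (hΩb : Bornology.IsBounded Ω)
    (hb : 1 ≤ b) (hN : 1 < N) (hL2 : 2 ≤ Real.log N)
    (hL : 6 ^ k * (10 + 4 * Real.log (4 * b)) ≤ Real.log N)
    (hbox : ∀ n, latticePoint n ∈ Ω → n ∈ latticeBox k (b * N)) (hφ : ContDiff ℝ 1 φ)
    (hA : 0 < A) (hφA : ∀ x, ‖φ x‖ ≤ A) (hφ' : ∀ x, ‖fderiv ℝ φ x‖ ≤ A * (1 + ‖x‖)⁻¹)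
    (hlarge : A * b ^ k * N ^ k * Real.log N ^ (-α) ≤ ‖weylSum P Ω φ‖) :
    IsLargeSum d (Real.log N ^ (α + 2)) (b * N)
      (fun γ => P.coeff (Finsupp.equivFunOnFinite.symm γ))
      (fun n => (A : ℂ)⁻¹ * latticeCutoff Ω φ n) := by
  set L := Real.log N with hLdef
  have hL0 : 0 < L := by linarith
  have hX1 : 1 ≤ b * N := by nlinarith
  have hAinv : ‖(A : ℂ)⁻¹‖ = A⁻¹ := by
    rw [norm_inv, Complex.norm_real, Real.norm_of_nonneg hA.le]
  refine ⟨fun n => ?_, fun n hn => ?_, fun i => ?_, ?_⟩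
  · have h1 : ‖latticeCutoff Ω φ n‖ ≤ A := by
      rw [latticeCutoff]
      split_ifs
      · exact hφA _
      · simpa using hA.le
    rw [norm_mul, hAinv]
    calc A⁻¹ * ‖latticeCutoff Ω φ n‖ ≤ A⁻¹ * A := by gcongr
      _ = 1 := by field_simp
  · refine hbox n ?_
    by_contra hcon
    refine right_ne_zero_of_mul hn ?_
    exact if_neg hcon
  · have h1 : variation (fun n => (A : ℂ)⁻¹ * latticeCutoff Ω φ n) (Pi.single i 1) =
        A⁻¹ * variation (latticeCutoff Ω φ) (Pi.single i 1) := by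
      rw [variation, variation, ← tsum_mul_left]
      refine tsum_congr fun n => ?_
      rw [← mul_sub, norm_mul, hAinv]
    have h2 := variation_latticeCutoff_mul_le hΩ hX1 hbox hφ hA.le hφA hφ' i
    have hlog : Real.log (4 * (b * N)) = Real.log (4 * b) + L := by
      rw [← mul_assoc, Real.log_mul (by positivity) (by positivity)]
    have hlog0 : 0 ≤ Real.log (4 * b) := Real.log_nonneg (by linarith)
    have h3 : (6 : ℝ) ^ k * (6 + 4 * Real.log (4 * (b * N))) ≤ L ^ (α + 2) := by
      calc (6 : ℝ) ^ k * (6 + 4 * Real.log (4 * (b * N)))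
          ≤ 6 ^ k * ((10 + 4 * Real.log (4 * b)) * L) := by
            gcongr
            rw [hlog]
            nlinarith
        _ = 6 ^ k * (10 + 4 * Real.log (4 * b)) * L := by ring
        _ ≤ L * L := by gcongr
        _ = L ^ (2 : ℝ) := by rw [Real.rpow_two]; ring
        _ ≤ L ^ (α + 2) := Real.rpow_le_rpow_of_exponent_le (by linarith) (by linarith)
    rw [h1, mul_assoc]
    calc A⁻¹ * (variation (latticeCutoff Ω φ) (Pi.single i 1) * (b * N))
        ≤ A⁻¹ * (A * (6 * (b * N)) ^ k * (6 + 4 * Real.log (4 * (b * N)))) := by gcongr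
      _ = 6 ^ k * (6 + 4 * Real.log (4 * (b * N))) * (b * N) ^ k := by
          rw [mul_pow 6 (b * N)]; field_simp
      _ ≤ L ^ (α + 2) * (b * N) ^ k := by gcongr
  · have h1 : ∑' n, ee (gridPoly d (fun γ => P.coeff (Finsupp.equivFunOnFinite.symm γ)) n) *
        ((A : ℂ)⁻¹ * latticeCutoff Ω φ n) = (A : ℂ)⁻¹ * weylSum P Ω φ := by
      rw [weylSum_eq_tsum hP hΩb, ← tsum_mul_left]
      exact tsum_congr fun n => by ring
    rw [h1, norm_mul, hAinv]
    have h2 : L ^ α * L ^ (-α) = 1 := by rw [← Real.rpow_add hL0]; simp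
    calc (b * N) ^ k = L ^ α * (A⁻¹ * (A * b ^ k * N ^ k * L ^ (-α))) := by
          rw [mul_pow]
          field_simp
          linear_combination (-1 : ℝ) * h2
      _ ≤ L ^ (α + 2) * (A⁻¹ * ‖weylSum P Ω φ‖) := by
          gcongr
          · linarith
          · linarith

theorem mainTheorem5 (k d : ℕ) (α : ℝ) (hα : 0 < α) :
    ∃ β₀ : ℝ, 0 < β₀ ∧ ∀ β : ℝ, β₀ ≤ β →
      ∀ c R A : ℝ, 0 < c → ∃ C : ℝ, 0 < C ∧
        ∀ N : ℝ, 1 < N →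
        ∀ P : MvPolynomial (Fin k) ℝ, P.totalDegree ≤ d → P.coeff 0 = 0 →
        ∀ γ₀ : Fin k →₀ ℕ, 0 < γ₀.degree → γ₀.degree ≤ d →
        ∀ a q : ℤ, 0 ≤ a → a ≤ q → IsCoprime a q →
          |P.coeff γ₀ - (a : ℝ) / (q : ℝ)| ≤ 1 / (q : ℝ) ^ 2 →
          Real.log N ^ β ≤ (q : ℝ) →
          (q : ℝ) ≤ N ^ γ₀.degree * Real.log N ^ (-β) →
        ∀ (x₀ : EuclideanSpace ℝ (Fin k)) (Ω : Set (EuclideanSpace ℝ (Fin k))),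
          ‖x₀‖ ≤ R * N → Convex ℝ Ω → Ω ⊆ Metric.closedBall x₀ (c * N) →
        ∀ φ : EuclideanSpace ℝ (Fin k) → ℂ, ContDiff ℝ 1 φ →
          (∀ x, ‖φ x‖ ≤ A) → (∀ x, ‖fderiv ℝ φ x‖ ≤ A * (1 + ‖x‖)⁻¹) →
          ‖weylSum P Ω φ‖ ≤ C * N ^ k * Real.log N ^ (-α) := by
  obtain ⟨B, hB⟩ := IsLargeSum.exists_common_denominator k d (k * d) 1 le_rfl (by omega)
  refine ⟨(α + 2) * B + 1, by positivity, fun β hβ c R A hc => ?_⟩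
  -- `Ω` lies in the box of size `b * N`; `A₁` is a positive bound for `φ`.
  set b := c + |R| + 1 with hb
  have hb1 : 1 ≤ b := by have := abs_nonneg R; linarith
  set A₁ := |A| + 1 with hA₁
  have hA₁0 : 0 < A₁ := by positivity
  set L₀ := max 3 (6 ^ k * (10 + 4 * Real.log (4 * b))) with hL₀
  have hL₀0 : 0 < L₀ := lt_of_lt_of_le (by norm_num) (le_max_left _ _)
  refine ⟨A₁ * (3 * b) ^ k * L₀ ^ α + A₁ * b ^ k, by positivity,
    fun N hN P hP _ γ₀ hγ₀ hγ₀d a q _ _ haq hξ hqL hqN x₀ Ω hx₀ hΩ hΩb φ hφ hφA hφ' => ?_⟩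
  have hN0 : 0 < N := by linarith
  have hL : 0 < Real.log N := Real.log_pos hN
  have hbd : Bornology.IsBounded Ω := Metric.isBounded_closedBall.subset hΩb
  have hX1 : 1 ≤ b * N := by nlinarith
  have hbox : ∀ n, latticePoint n ∈ Ω → n ∈ latticeBox k (b * N) := fun n hn =>
    mem_latticeBox_of_mem_closedBall hx₀ hΩb (by rw [hb]; nlinarith [le_abs_self R]) hn
  have hAA₁ : A ≤ A₁ := (le_abs_self A).trans (by rw [hA₁]; linarith)
  have hφA₁ : ∀ x, ‖φ x‖ ≤ A₁ := fun x => (hφA x).trans hAA₁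
  have hφ₁' : ∀ x, ‖fderiv ℝ φ x‖ ≤ A₁ * (1 + ‖x‖)⁻¹ := fun x =>
    (hφ' x).trans (by gcongr)
  have hmono : ∀ {C₁ : ℝ}, C₁ ≤ A₁ * (3 * b) ^ k * L₀ ^ α + A₁ * b ^ k →
      C₁ * N ^ k * Real.log N ^ (-α) ≤
        (A₁ * (3 * b) ^ k * L₀ ^ α + A₁ * b ^ k) * N ^ k * Real.log N ^ (-α) := by
    intro C₁ hC₁
    gcongr
  rcases le_or_gt (Real.log N) L₀ with hsmall | hbig
  · refine le_trans ?_ (hmono (C₁ := A₁ * (3 * b) ^ k * L₀ ^ α)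
      (le_add_of_nonneg_right (by positivity)))
    have h1 : 1 ≤ L₀ ^ α * Real.log N ^ (-α) := by
      rw [Real.rpow_neg hL.le, ← div_eq_mul_inv, one_le_div (by positivity)]
      exact Real.rpow_le_rpow hL.le hsmall hα.le
    calc ‖weylSum P Ω φ‖ ≤ A₁ * (3 * (b * N)) ^ k := norm_weylSum_le hP hbd hA₁0.le hX1 hbox hφA₁
      _ = A₁ * (3 * b) ^ k * N ^ k * 1 := by rw [← mul_assoc, mul_pow]; ring
      _ ≤ A₁ * (3 * b) ^ k * N ^ k * (L₀ ^ α * Real.log N ^ (-α)) := by gcongr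
      _ = _ := by ring
  · refine le_trans ?_ (hmono (C₁ := A₁ * b ^ k) (le_add_of_nonneg_left (by positivity)))
    by_contra! hcon
    set L := Real.log N with hLdef
    have hL3 : 3 < L := (le_max_left _ _).trans_lt hbig
    have hlarge := isLargeSum_latticeCutoff hα hP hΩ hbd hb1 hN (by linarith)
      ((le_max_right _ _).trans hbig.le) hbox hφ hA₁0 hφA₁ hφ₁' hcon.le
    have hK2 : 2 ≤ L ^ (α + 2) := by
      calc (2 : ℝ) ≤ L ^ (1 : ℝ) := by rw [Real.rpow_one]; linarith
        _ ≤ L ^ (α + 2) := Real.rpow_le_rpow_of_exponent_le (by linarith) (by linarith)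
    obtain ⟨r, hr1, hrK, hr⟩ := hB _ _ _ _ hK2 hX1 hlarge
    have hdeg : ∑ i, (γ₀ : Fin k → ℕ) i = γ₀.degree := (Finsupp.degree_eq_sum γ₀).symm
    have hγ := hr γ₀ (mem_indexGrid.2 fun i => (Finsupp.le_degree i γ₀).trans hγ₀d)
      (by rw [hdeg]; exact hγ₀)
    rw [hdeg] at hγ
    simp only [Finsupp.equivFunOnFinite_symm_coe] at hγ
    set Q := (L ^ (α + 2)) ^ B with hQ
    have hQ' : Q = L ^ ((α + 2) * B) := by rw [hQ, Real.rpow_mul_natCast hL.le]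
    -- The exponent `β` exceeds that of `Q` by at least one, and `log N > 2`.
    have hQβ : 2 * Q < L ^ β := by
      calc 2 * Q < L * Q := by
            have : 0 < Q := by positivity
            nlinarith
        _ = L ^ ((α + 2) * B + 1) := by rw [hQ', Real.rpow_add_one hL.ne']; ring
        _ ≤ L ^ β := Real.rpow_le_rpow_of_exponent_le (by linarith) hβ
    have hLβ : 0 < L ^ β := by positivity
    have hq0 : 0 < q := by
      have : (0 : ℝ) < q := hLβ.trans_le hqL
      exact_mod_cast this
    have hq : (0 : ℝ) < q := by exact_mod_cast hq0
    refine false_of_two_approximations (D := N ^ γ₀.degree) haq hq0 hξ (by positivity) hr1 hrK ?_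
      (hQβ.trans_le hqL) ?_
    · refine le_trans ?_ hγ
      gcongr
      · exact distInt_nonneg _
      · nlinarith
    · rw [Real.rpow_neg hL.le, ← div_eq_mul_inv, le_div_iff₀ hLβ] at hqN
      calc 2 * Q * q < L ^ β * q := by gcongr
        _ = q * L ^ β := mul_comm _ _
        _ ≤ N ^ γ₀.degree := hqN
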